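/- **Setting.** A state is $\mathbf U=(D,\mathbf m,\mathbf B,E)^\top\in\mathbb R^8$ with $\mathbf m,\mathbf B\in\mathbb R^3$. Let $H=H(p,\rho)$ be a specific enthalpy that is differentiable on $\{p,\rho>0\}$ and satisfies, for all $p,\rho>0$, $$H\ge\sqrt{1+p^2/\rho^2}+p/\rho,\qquad H\Big(\tfrac1\rho-\tfrac{\partial H}{\partial p}\Big)<\tfrac{\partial H}{\partial\rho}<0,\qquad \lim_{p\to0^+}H(p,\rho)=1 .$$ Primitive variables $(\rho,p,\mathbf v,\mathbf B)$ with $|\mathbf v|<1$ determine, with $W=(1-|\mathbf v|^2)^{-1/2}$ and $p_{tot}=p+\frac12(W^{-2}|\mathbf B|^2+(\mathbf v\cdot\mathbf B)^2)$, the state $$D=\rho W,\quad \mathbf m=(\rho HW^2+|\mathbf B|^2)\mathbf v-(\mathbf v\cdot\mathbf B)\mathbf B,\quad E=\rho HW^2-p_{tot}+|\mathbf B|^2,$$ the fluxes $$\mathbf F_i=\big(Dv_i,\ v_i\mathbf m-B_i(W^{-2}\mathbf B+(\mathbf v\cdot\mathbf B)\mathbf v)+p_{tot}\mathbf e_i,\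 v_i\mathbf B-B_i\mathbf v,\ m_i\big)^\top$$ and the source vector $$\mathbf S=\big(0,\ (1-|\mathbf v|^2)\mathbf B+(\mathbf v\cdot\mathbf B)\mathbf v,\ \mathbf v,\ \mathbf v\cdot\mathbf B\big)^\top .$$ Let $\mathcal G$ be the set of states that arise from primitive variables with $\rho>0$, $p>0$, $e:=H-1-p/\rho>0$, $|\mathbf v|<1$; on $\mathcal G$ the quantities $\rho,H,\mathbf v,\mathbf F_i,\mathbf S$ are regarded as functions of $\mathbf U$. **Mesh and quadrature.** Let $\mathcal T_h$ be a finite conforming mesh of a planar domain $\Omega$ into (closed) polygonal cells $K$, with areas $|K|$, edges $\mathscr E\in\partial K$ of lengths $|\mathscr E|$ and outward unit normals $\mathbf n_{\mathscr E,K}$, and let $k\ge0$. Let an edge quadrature with points $\mathbf x_{\mathscr E}^{(q)}\in\mathscr E$ and weights $\omega_q>0$, $1\le q\le Q$, $\sum_q\omega_q=1$, be given that is symmetric about the midpoint and exact for degree $\le 2k$ (e.g. the Gauss rule with $Q=k+1$), and on every $K$ a quadrature with points $\breve{\mathbf x}_K^{(q)}\in K$ and weights $\breve\omega_q$ that is exact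 for degree $\le 2k$. Assume that on every $K$ there are weights $\varpi_{\mathscr E}^{(q)},\widetilde\varpi_q>0$ and points $\widetilde{\mathbf x}_K^{(q)}\in K$ with $$\frac1{|K|}\int_Ku\,d\mathbf x=\sum_{\mathscr E\in\partial K}\sum_{q=1}^Q\varpi_{\mathscr E}^{(q)}u(\mathbf x_{\mathscr E}^{(q)})+\sum_q\widetilde\varpi_q\,u(\widetilde{\mathbf x}_K^{(q)})\qquad\text{for all polynomials }u\text{ of degree}\le k,$$ and let $\mathbb S_K$ consist of all the points $\mathbf x_{\mathscr E}^{(q)}$ $(\mathscr E\in\partial K)$, $\widetilde{\mathbf x}_K^{(q)}$ and $\breve{\mathbf x}_K^{(q)}$. Let $\mathbb W_h^k$ be the space of $\mathbb R^8$-valued functions $(D,\mathbf m,\mathbf B,E)$ that are polynomial of total degree $\le k$ on each cell and satisfy $\partial_{x_1}B_1+\partial_{x_2}B_2=0$ in each cell. Write $\bar{\mathbf u}_K$ for the average of $\mathbf u$ over $K$ and put $$\overline{\mathbb G}_h^k=\{\mathbf u\in\mathbb W_h^k:\bar{\mathbf u}_K\in\mathcal G\ \forall K\},\qquad \mathbb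 G_h^k=\{\mathbf u\in\overline{\mathbb G}_h^k:\mathbf u|_K(\mathbf x)\in\mathcal G\ \forall\mathbf x\in\mathbb S_K,\ \forall K\}.$$ **Spatial operator.** For $\mathbf u\in\mathbb W_h^k$ let $\mathbf u^{\rm int},\mathbf u^{\rm ext}$ be its traces at $\mathbf x_{\mathscr E}^{(q)}$ from $K$ and from the cell on the other side of $\mathscr E$. On edges contained in $\partial\Omega$, $\mathbf u^{\rm ext}$ is prescribed by a boundary rule (a function of $\mathbf u$) whose values lie in $\mathcal G$ whenever $\mathbf u\in\mathbb G_h^k$. With $a=1$, $\langle\mathbf n,\mathbf F\rangle=n_1\mathbf F_1+n_2\mathbf F_2$, $\langle\mathbf n,\mathbf B\rangle=n_1B_1+n_2B_2$ and $$\hat{\mathbf F}=\tfrac12\big(\langle\mathbf n_{\mathscr E,K},\mathbf F(\mathbf u^{\rm int})+\mathbf F(\mathbf u^{\rm ext})\rangle-a(\mathbf u^{\rm ext}-\mathbf u^{\rm int})\big),$$ $\mathbf L_h(\mathbf u)\in\mathbb W_h^k$ is defined by requiring, for all $K$ and all $\mathbf w\in\mathbb W_h^k$, $$\int_K\mathbf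 L_h(\mathbf u)\cdot\mathbf w\,d\mathbf x=-\sum_{\mathscr E\in\partial K}|\mathscr E|\sum_{q}\omega_q\Big[\hat{\mathbf F}+\tfrac12\langle\mathbf n_{\mathscr E,K},\mathbf B^{\rm ext}-\mathbf B^{\rm int}\rangle\,\mathbf S(\mathbf u^{\rm int})\Big]\cdot\mathbf w^{\rm int}(\mathbf x_{\mathscr E}^{(q)})+|K|\sum_q\breve\omega_q\sum_{i=1}^2\mathbf F_i(\mathbf u(\breve{\mathbf x}_K^{(q)}))\cdot\partial_{x_i}\mathbf w(\breve{\mathbf x}_K^{(q)}).$$ Let $\sigma_{K,\mathscr E,q}(\mathbf u)=\tfrac12\big|\langle\mathbf n_{\mathscr E,K},\mathbf B^{\rm int}-\mathbf B^{\rm ext}\rangle\big|\big/\sqrt{\rho^{\rm int}H^{\rm int}}$, evaluated at $\mathbf x_{\mathscr E}^{(q)}$. **Limiter.** Let $q(\mathbf U)=E-\sqrt{D^2+|\mathbf m|^2}$, $\Phi=\sqrt{(|\mathbf B|^2-E)^2+3(E^2-D^2-|\mathbf m|^2)}$, $$\Psi(\mathbf U)=(\Phi-2(|\mathbf B|^2-E))\sqrt{\Phi+|\mathbf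 B|^2-E}-\sqrt{\tfrac{27}2\big(D^2|\mathbf B|^2+(\mathbf m\cdot\mathbf B)^2\big)},$$ $\Psi_\epsilon(\mathbf U)=\Psi(D,\mathbf m,\mathbf B,E-\epsilon)$ and $\mathcal G_\epsilon=\{D\ge\epsilon,\ q\ge\epsilon,\ \Psi_\epsilon\ge0\}$. For $\mathbf u\in\overline{\mathbb G}_h^k$ choose any $\epsilon=\epsilon(\mathbf u)>0$ with $\bar{\mathbf u}_K\in\mathcal G_\epsilon$ for all $K$. On each cell $K$: 1. $\widehat{\mathbf u}$ is $\mathbf u$ with $D$ replaced by $\theta_1(D-\bar D_K)+\bar D_K$, where $\theta_1=\min\{1,(\bar D_K-\epsilon)/(\bar D_K-\min_{\mathbb S_K}D)\}$; 2. $\check{\mathbf u}$ is $\theta_2(\widehat{\mathbf u}-\bar{\mathbf u}_K)+\bar{\mathbf u}_K$ in the components $D,\mathbf m,E$ and $\mathbf u$ in the component $\mathbf B$, where $\theta_2=\min\{1,(q(\bar{\mathbf u}_K)-\epsilon)/(q(\bar{\mathbf u}_K)-\min_{\mathbb S_K}q(\widehat{\mathbf u}))\}$; 3. $\boldsymbol\Pi_h\mathbf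 u=\theta_3(\check{\mathbf u}-\bar{\mathbf u}_K)+\bar{\mathbf u}_K$, where $\theta_3=\min_{\mathbf x\in\mathbb S_K}\tilde\theta(\mathbf x)$, $\tilde\theta(\mathbf x)=1$ if $\Psi_\epsilon(\check{\mathbf u}(\mathbf x))\ge0$, and otherwise $\tilde\theta(\mathbf x)\in[0,1)$ is a solution of $\Psi_\epsilon\big((1-\tilde\theta)\bar{\mathbf u}_K+\tilde\theta\,\check{\mathbf u}(\mathbf x)\big)=0$. A quotient with denominator $0$ counts as $+\infty$. **Scheme.** Let $N_r$ be the number of Runge–Kutta stages and $\alpha_{i\ell},\beta_{i\ell}\ge0$ $(0\le\ell<i\le N_r)$ with $\sum_{\ell<i}\alpha_{i\ell}=1$ for $1\le i\le N_r$. Let $\mathbf P_w$ be the $L^2(\Omega)$-projection onto $\mathbb W_h^k$, and let $\mathbf U_0\in L^2(\Omega)^8$ satisfy $\mathbf U_0(\mathbf x)\in\mathcal G$ for all $\mathbf x\in\Omega$. Put $\mathbf U_h^0=\boldsymbol\Pi_h\mathbf P_w\mathbf U_0$ and, for $0\le n<N_t$ and step sizes $\Delta t_n>0$: $\mathbf U_h^{(n,0)}=\mathbf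 U_h^n$, $$\mathbf U_h^{(n,i)}=\boldsymbol\Pi_h\Big\{\sum_{\ell=0}^{i-1}\alpha_{i\ell}\big(\mathbf U_h^{(n,\ell)}+\beta_{i\ell}\Delta t_n\mathbf L_h(\mathbf U_h^{(n,\ell)})\big)\Big\}\quad(1\le i\le N_r),\qquad \mathbf U_h^{n+1}=\mathbf U_h^{(n,N_r)}.$$ **Theorem.** Assume the CFL condition $$\Delta t_n\le\frac{\varpi_{\mathscr E}^{(q)}|K|}{\beta_{i\ell}\,\omega_q\,\big(a+\sigma_{K,\mathscr E,q}(\mathbf U_h^{(n,\ell)})\big)|\mathscr E|}$$ for all $0\le n<N_t$, all $0\le\ell<i\le N_r$ with $\beta_{i\ell}\ne0$, all cells $K$, all $\mathscr E\in\partial K$ and all $1\le q\le Q$. Then $\mathbf U_h^n\in\mathbb G_h^k$ for all $0\le n\le N_t$. -/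

import Mathlib

open MeasureTheory Set Filter Topology
open scoped Matrix

noncomputable section

namespace RMHD

/-! ## States, equation of state, flux and source of special RMHD -/

/-- Conservative states `U = (D, m, B, E)`: entry `0` is `D`, entries `1, 2, 3` are `m`,
entries `4, 5, 6` are `B`, entry `7` is `E`. -/
abbrev State := Fin 8 → ℝ

/-- Assemble a vector of `ℝ⁸` from its four blocks. -/
def pack (D : ℝ) (m B : Fin 3 → ℝ) (E : ℝ) : State :=
  ![D, m 0, m 1, m 2, B 0, B 1, B 2, E]

/-- The momentum block. -/
def momOf (U : State) : Fin 3 → ℝ := ![U 1, U 2, U 3]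

/-- The magnetic block. -/
def magOf (U : State) : Fin 3 → ℝ := ![U 4, U 5, U 6]

/-- Causal equation of state, given by the specific enthalpy `H(p, ρ)`. -/
structure IsCausalEOS (H : ℝ → ℝ → ℝ) : Prop where
  differentiable : ∀ p ρ : ℝ, 0 < p → 0 < ρ →
    DifferentiableAt ℝ (fun z : ℝ × ℝ => H z.1 z.2) (p, ρ)
  kinetic : ∀ p ρ : ℝ, 0 < p → 0 < ρ → √(1 + p ^ 2 / ρ ^ 2) + p / ρ ≤ H p ρ
  causal : ∀ p ρ : ℝ, 0 < p → 0 < ρ →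
    H p ρ * (1 / ρ - deriv (fun p' => H p' ρ) p) < deriv (fun ρ' => H p ρ') ρ
  expansion : ∀ p ρ : ℝ, 0 < p → 0 < ρ → deriv (fun ρ' => H p ρ') ρ < 0
  /-- The specific internal energy `e = H - 1 - p/ρ` vanishes in the cold limit `p → 0⁺`. -/
  cold : ∀ ρ : ℝ, 0 < ρ → Tendsto (fun p => H p ρ) (𝓝[>] 0) (𝓝 1)

/-- Primitive variables `(ρ, p, v, B)`. -/
structure Prim where
  rho : ℝ
  p : ℝ
  v : Fin 3 → ℝ
  B : Fin 3 → ℝ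

namespace Prim

variable (H : ℝ → ℝ → ℝ) (w : Prim)

/-- Specific enthalpy of a primitive state. -/
def enthalpy : ℝ := H w.p w.rho

/-- Specific internal energy: `H = 1 + e + p/ρ`. -/
def internalEnergy : ℝ := w.enthalpy H - 1 - w.p / w.rho

/-- The physical constraints. -/
def Physical : Prop :=
  0 < w.rho ∧ 0 < w.p ∧ 0 < w.internalEnergy H ∧ √(w.v ⬝ᵥ w.v) < 1

/-- Lorentz factor. -/
def lorentz : ℝ := 1 / √(1 - w.v ⬝ᵥ w.v)

/-- Total (thermal plus magnetic) pressure. -/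
def pTot : ℝ := w.p + (w.lorentz⁻¹ ^ 2 * (w.B ⬝ᵥ w.B) + (w.v ⬝ᵥ w.B) ^ 2) / 2

/-- Momentum density. -/
def mom : Fin 3 → ℝ :=
  (w.rho * w.enthalpy H * w.lorentz ^ 2 + w.B ⬝ᵥ w.B) • w.v - (w.v ⬝ᵥ w.B) • w.B

/-- The conservative vector of a primitive state. -/
def toCons : State :=
  pack (w.rho * w.lorentz) (w.mom H) w.B
    (w.rho * w.enthalpy H * w.lorentz ^ 2 - w.pTot + w.B ⬝ᵥ w.B)

/-- The flux `F_i` in the `i`-th coordinate direction. -/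
def flux (i : Fin 3) : State :=
  pack (w.rho * w.lorentz * w.v i)
    (w.v i • w.mom H - w.B i • (w.lorentz⁻¹ ^ 2 • w.B + (w.v ⬝ᵥ w.B) • w.v)
      + w.pTot • Pi.single i (1 : ℝ))
    (w.v i • w.B - w.B i • w.v)
    (w.mom H i)

/-- The source vector `S` of the symmetrizable system. -/
def source : State :=
  pack 0 ((1 - w.v ⬝ᵥ w.v) • w.B + (w.v ⬝ᵥ w.B) • w.v) w.v (w.v ⬝ᵥ w.B)

end Prim

/-- The set `𝒢` of physically admissible states. -/
def Adm (H : ℝ → ℝ → ℝ) : Set State := {U | ∃ w : Prim, w.Physical H ∧ w.toCons H = U}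

open Classical in
/-- The primitive variables `ρ(U), p(U), v(U), B` of an admissible state: primitive variables that
satisfy the physical constraints and have conservative vector `U` (arbitrary value on other
states). -/
def prim (H : ℝ → ℝ → ℝ) (U : State) : Prim :=
  if h : ∃ w : Prim, w.Physical H ∧ w.toCons H = U then h.choose else ⟨0, 0, 0, 0⟩

/-- The function `q(U) = E - √(D² + |m|²)`. -/
def qFun (U : State) : ℝ := U 7 - √(U 0 ^ 2 + momOf U ⬝ᵥ momOf U)

/-- The function `Φ(U)`. -/
def phiFun (U : State) : ℝ :=
  √((magOf U ⬝ᵥ magOf U - U 7) ^ 2 + 3 * (U 7 ^ 2 - U 0 ^ 2 - momOf U ⬝ᵥ momOf U))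

/-- The function `Ψ(U)`. -/
def psiFun (U : State) : ℝ :=
  (phiFun U - 2 * (magOf U ⬝ᵥ magOf U - U 7)) * √(phiFun U + magOf U ⬝ᵥ magOf U - U 7)
    - √(27 / 2 * (U 0 ^ 2 * (magOf U ⬝ᵥ magOf U) + (momOf U ⬝ᵥ magOf U) ^ 2))

/-- `Ψ_ε(U) = Ψ(D, m, B, E - ε)`. -/
def psiEps (ε : ℝ) (U : State) : ℝ := psiFun (Function.update U 7 (U 7 - ε))

/-- The set `𝒢_ε`. -/
def AdmEps (ε : ℝ) : Set State := {U | ε ≤ U 0 ∧ ε ≤ qFun U ∧ 0 ≤ psiEps ε U}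

/-! ## Polygonal meshes of planar domains -/

/-- Points of the plane. -/
abbrev Pt := Fin 2 → ℝ

/-- Euclidean length of the segment from `a` to `b`. -/
def edgeLen (a b : Pt) : ℝ := √((b 0 - a 0) ^ 2 + (b 1 - a 1) ^ 2)

/-- Unit normal to the right of the oriented segment from `a` to `b`. -/
def edgeNormal (a b : Pt) : Pt :=
  ![(b 1 - a 1) / edgeLen a b, -(b 0 - a 0) / edgeLen a b]

/-- A closed polygonal cell: the region enclosed by a simple closed polygon whose vertices are
listed counterclockwise (the cell lies to the left of every edge, so that `edgeNormal` is
the outward unit normal). Edge `j` runs from `vertex j` to `vertex (finRotate nv j)`, the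
cyclically next vertex. Angles equal to `π` are allowed. -/
structure PolygonalCell where
  nv : ℕ
  three_le : 3 ≤ nv
  vertex : Fin nv → Pt
  vertex_injective : Function.Injective vertex
  simple : ∀ i j : Fin nv, i ≠ j →
    segment ℝ (vertex i) (vertex (finRotate nv i)) ∩ segment ℝ (vertex j) (vertex (finRotate nv j))
      ⊆ {vertex i, vertex (finRotate nv i)} ∩ {vertex j, vertex (finRotate nv j)}
  carrier : Set Pt
  isCompact : IsCompact carrier
  regular : closure (interior carrier) = carrier
  frontier_eq : frontier carrier = ⋃ j, segment ℝ (vertex j) (vertex (finRotate nv j))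
  outward : ∀ j : Fin nv, ∀ x ∈ openSegment ℝ (vertex j) (vertex (finRotate nv j)),
    ∀ᶠ s : ℝ in 𝓝[>] 0,
      x - s • edgeNormal (vertex j) (vertex (finRotate nv j)) ∈ interior carrier ∧
      x + s • edgeNormal (vertex j) (vertex (finRotate nv j)) ∉ carrier

namespace PolygonalCell

variable (P : PolygonalCell)

/-- Initial point of edge `j`. -/
def src (j : Fin P.nv) : Pt := P.vertex j

/-- Final point of edge `j`. -/
def tgt (j : Fin P.nv) : Pt := P.vertex (finRotate P.nv j)

/-- Length of edge `j`. -/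
def len (j : Fin P.nv) : ℝ := edgeLen (P.src j) (P.tgt j)

/-- Outward unit normal on edge `j`. -/
def normal (j : Fin P.nv) : Pt := edgeNormal (P.src j) (P.tgt j)

/-- Area of the cell. -/
def area : ℝ := volume.real P.carrier

/-- The point of edge `j` with parameter `s ∈ [0, 1]`. -/
def edgePt (j : Fin P.nv) (s : ℝ) : Pt := P.src j + s • (P.tgt j - P.src j)

end PolygonalCell

/-- A conforming mesh of polygonal cells. `neighbor K j` is the cell on the other side of
edge `j` of `K` together with the index of the same edge in that cell (where it is traversed
in the opposite direction), or `none` if the edge lies on the boundary of the domain. Hanging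
nodes are covered by counting them as vertices. -/
structure PolygonalMesh (ι : Type*) where
  cell : ι → PolygonalCell
  disjoint : Pairwise fun K K' => Disjoint (interior (cell K).carrier) (interior (cell K').carrier)
  neighbor : (K : ι) → Fin (cell K).nv → Option ((K' : ι) × Fin (cell K').nv)
  neighbor_some : ∀ K j K' j', neighbor K j = some ⟨K', j'⟩ →
    K' ≠ K ∧ (cell K').src j' = (cell K).tgt j ∧ (cell K').tgt j' = (cell K).src j
  neighbor_none : ∀ K j, neighbor K j = none →
    segment ℝ ((cell K).src j) ((cell K).tgt j) ⊆ frontier (⋃ K', (cell K').carrier)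

/-- The (closed) domain covered by the mesh. -/
def PolygonalMesh.domain {ι : Type*} (M : PolygonalMesh ι) : Set Pt := ⋃ K, (M.cell K).carrier

/-! ## Quadrature rules -/

/-- Edge quadrature on `[0, 1]` with positive weights of total mass one, symmetric about the
midpoint (so that the two cells sharing an edge use the same points), and exact for
polynomials of degree at most `2k`. The Gauss rule with `k + 1` points is an example. -/
structure EdgeRule (k : ℕ) where
  Q : ℕ
  node : Fin Q → ℝ
  weight : Fin Q → ℝ
  node_mem : ∀ q, node q ∈ Icc (0 : ℝ) 1
  weight_pos : ∀ q, 0 < weight q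
  node_rev : ∀ q, node q.rev = 1 - node q
  weight_rev : ∀ q, weight q.rev = weight q
  exact : ∀ r : ℕ, r ≤ 2 * k → ∑ q, weight q * node q ^ r = ∫ s in (0 : ℝ)..1, s ^ r

/-- The two quadratures attached to a cell: the rule used for the element integrals, and the
auxiliary rule with positive weights whose points contain all edge quadrature points. -/
structure CellRule (P : PolygonalCell) {k : ℕ} (R : EdgeRule k) where
  /-- Number, points and weights of the rule for the element integrals. -/
  volNum : ℕ
  volNode : Fin volNum → Pt
  volWeight : Fin volNum → ℝ
  volNode_mem : ∀ q, volNode q ∈ P.carrier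
  vol_exact : ∀ u : MvPolynomial (Fin 2) ℝ, u.totalDegree ≤ 2 * k →
    P.area * ∑ q, volWeight q * MvPolynomial.eval (volNode q) u
      = ∫ x in P.carrier, MvPolynomial.eval x u
  /-- Weights of the auxiliary rule at the edge quadrature points. -/
  edgeWeight : Fin P.nv → Fin R.Q → ℝ
  edgeWeight_pos : ∀ j q, 0 < edgeWeight j q
  /-- The remaining points and weights of the auxiliary rule. -/
  auxNum : ℕ
  auxNode : Fin auxNum → Pt
  auxWeight : Fin auxNum → ℝ
  auxNode_mem : ∀ q, auxNode q ∈ P.carrier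
  auxWeight_pos : ∀ q, 0 < auxWeight q
  aux_exact : ∀ u : MvPolynomial (Fin 2) ℝ, u.totalDegree ≤ k →
    1 / P.area * ∫ x in P.carrier, MvPolynomial.eval x u
      = ∑ j, ∑ q, edgeWeight j q * MvPolynomial.eval (P.edgePt j (R.node q)) u
        + ∑ q, auxWeight q * MvPolynomial.eval (auxNode q) u

/-- A mesh with quadrature rules, for polynomial degree `k`. -/
structure Discretization (ι : Type*) (k : ℕ) where
  mesh : PolygonalMesh ι
  edgeRule : EdgeRule k
  cellRule : (K : ι) → CellRule (mesh.cell K) edgeRule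

/-- `ℝ⁸`-valued piecewise polynomials, one polynomial vector per cell. -/
abbrev PW (ι : Type*) := ι → Fin 8 → MvPolynomial (Fin 2) ℝ

/-- The value at `x` of the polynomial vector of cell `K`. -/
def evalAt {ι : Type*} (u : PW ι) (K : ι) (x : Pt) : State :=
  fun l => MvPolynomial.eval x (u K l)

/-- The locally divergence-free space `𝕎_h^k`. -/
def divFreeSpace (ι : Type*) (k : ℕ) : Submodule ℝ (PW ι) where
  carrier := {u | ∀ K, (∀ l, u K l ∈ MvPolynomial.restrictTotalDegree (Fin 2) ℝ k) ∧
    MvPolynomial.pderiv 0 (u K 4) + MvPolynomial.pderiv 1 (u K 5) = 0}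
  add_mem' {u w} hu hw K := by
    refine ⟨fun l => Submodule.add_mem _ ((hu K).1 l) ((hw K).1 l), ?_⟩
    simp only [Pi.add_apply, map_add]
    linear_combination (hu K).2 + (hw K).2
  zero_mem' K := ⟨fun _ => Submodule.zero_mem _, by simp⟩
  smul_mem' c u hu K := by
    refine ⟨fun l => Submodule.smul_mem _ c ((hu K).1 l), ?_⟩
    have h := (hu K).2
    simp only [Pi.smul_apply, Derivation.map_smul, ← smul_add, h, smul_zero]

/-- An exterior state for every edge quadrature point on the boundary of the domain, as a
function of the discrete solution. -/
abbrev BoundaryRule {ι : Type*} {k : ℕ} (T : Discretization ι k) :=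
  PW ι → (K : ι) → Fin (T.mesh.cell K).nv → Fin T.edgeRule.Q → State

namespace Discretization

variable {ι : Type*} {k : ℕ} (T : Discretization ι k)

/-! ## The discrete admissible sets -/

/-- The edge quadrature point `x_ℰ^{(q)}` on edge `j` of cell `K`. -/
def edgeNode (K : ι) (j : Fin (T.mesh.cell K).nv) (q : Fin T.edgeRule.Q) : Pt :=
  (T.mesh.cell K).edgePt j (T.edgeRule.node q)

/-- The set `𝕊_K` of critical points of the cell `K`. -/
def critPts (K : ι) : Set Pt :=
  ((range fun jq : Fin (T.mesh.cell K).nv × Fin T.edgeRule.Q => T.edgeNode K jq.1 jq.2)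
    ∪ range (T.cellRule K).auxNode) ∪ range (T.cellRule K).volNode

/-- The cell average of a piecewise polynomial vector. -/
def cellAvg (u : PW ι) (K : ι) : State :=
  fun l => 1 / (T.mesh.cell K).area * ∫ x in (T.mesh.cell K).carrier, evalAt u K x l

/-- The set of discrete functions with admissible cell averages. -/
def weakSet (H : ℝ → ℝ → ℝ) : Set (PW ι) :=
  {u | u ∈ divFreeSpace ι k ∧ ∀ K, T.cellAvg u K ∈ Adm H}

/-- The set `𝔾_h^k` of discrete functions with admissible cell averages and admissible values
at the critical points. -/
def strongSet (H : ℝ → ℝ → ℝ) : Set (PW ι) :=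
  {u | u ∈ T.weakSet H ∧ ∀ K, ∀ x ∈ T.critPts K, evalAt u K x ∈ Adm H}

/-! ## The spatial operator -/

/-- Interior trace of `u` at an edge quadrature point. -/
def intState (u : PW ι) (K : ι) (j : Fin (T.mesh.cell K).nv) (q : Fin T.edgeRule.Q) : State :=
  evalAt u K (T.edgeNode K j q)

/-- Exterior trace of `u` at an edge quadrature point. -/
def extState (bc : BoundaryRule T) (u : PW ι) (K : ι) (j : Fin (T.mesh.cell K).nv)
    (q : Fin T.edgeRule.Q) : State :=
  match T.mesh.neighbor K j with
  | some e => evalAt u e.1 (T.edgeNode K j q)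
  | none => bc u K j q

/-- The normal flux `⟨n, F(U)⟩`. -/
def normalFlux (H : ℝ → ℝ → ℝ) (n : Pt) (U : State) : State :=
  n 0 • (prim H U).flux H 0 + n 1 • (prim H U).flux H 1

/-- The normal component `⟨n, B⟩` of the magnetic field. -/
def normalMag (n : Pt) (U : State) : ℝ := n 0 * magOf U 0 + n 1 * magOf U 1

/-- Numerical viscosity: the speed of light. -/
def visc : ℝ := 1

/-- The global Lax–Friedrichs flux. -/
def numFlux (H : ℝ → ℝ → ℝ) (Ui Ue : State) (n : Pt) : State :=
  (1 / 2 : ℝ) • (normalFlux H n Ui + normalFlux H n Ue - visc • (Ue - Ui))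

/-- Edge contribution of the numerical flux to the weak form. -/
def J1 (H : ℝ → ℝ → ℝ) (bc : BoundaryRule T) (u : PW ι) (K : ι) (w : PW ι) : ℝ :=
  -∑ j, (T.mesh.cell K).len j * ∑ q, T.edgeRule.weight q *
    (numFlux H (T.intState u K j q) (T.extState bc u K j q) ((T.mesh.cell K).normal j)
      ⬝ᵥ evalAt w K (T.edgeNode K j q))

/-- Edge contribution of the source term to the weak form. -/
def J2 (H : ℝ → ℝ → ℝ) (bc : BoundaryRule T) (u : PW ι) (K : ι) (w : PW ι) : ℝ :=
  -(1 / 2) * ∑ j, (T.mesh.cell K).len j * ∑ q, T.edgeRule.weight q *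
    (normalMag ((T.mesh.cell K).normal j) (T.extState bc u K j q)
        - normalMag ((T.mesh.cell K).normal j) (T.intState u K j q)) *
    ((prim H (T.intState u K j q)).source ⬝ᵥ evalAt w K (T.edgeNode K j q))

/-- Volume contribution to the weak form. -/
def J3 (H : ℝ → ℝ → ℝ) (u : PW ι) (K : ι) (w : PW ι) : ℝ :=
  (T.mesh.cell K).area * ∑ q, (T.cellRule K).volWeight q *
    ∑ l, ((prim H (evalAt u K ((T.cellRule K).volNode q))).flux H 0 l *
            MvPolynomial.eval ((T.cellRule K).volNode q) (MvPolynomial.pderiv 0 (w K l))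
        + (prim H (evalAt u K ((T.cellRule K).volNode q))).flux H 1 l *
            MvPolynomial.eval ((T.cellRule K).volNode q) (MvPolynomial.pderiv 1 (w K l)))

/-- The right-hand side `𝒥_K(u, w)` of the weak form. -/
def weakForm (H : ℝ → ℝ → ℝ) (bc : BoundaryRule T) (u : PW ι) (K : ι) (w : PW ι) : ℝ :=
  T.J1 H bc u K w + T.J2 H bc u K w + T.J3 H u K w

/-- `L` represents the semidiscrete right-hand side at `u`:
`∫_K L · w = 𝒥_K(u, w)` for all cells `K` and all test functions `w`. -/
def IsSpatialOperator (H : ℝ → ℝ → ℝ) (bc : BoundaryRule T) (u L : PW ι) : Prop :=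
  L ∈ divFreeSpace ι k ∧ ∀ K, ∀ w ∈ divFreeSpace ι k,
    ∫ x in (T.mesh.cell K).carrier, evalAt L K x ⬝ᵥ evalAt w K x = T.weakForm H bc u K w

/-- `v` is the `L²(Ω)`-projection of `u` onto the discrete space. -/
def IsL2Projection [Fintype ι] (u : Pt → State) (v : PW ι) : Prop :=
  v ∈ divFreeSpace ι k ∧ ∀ w ∈ divFreeSpace ι k,
    ∑ K, ∫ x in (T.mesh.cell K).carrier, evalAt v K x ⬝ᵥ evalAt w K x
      = ∑ K, ∫ x in (T.mesh.cell K).carrier, u x ⬝ᵥ evalAt w K x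

/-! The discrete space with its `L²` inner product represents every linear functional, hence the
spatial operator and the `L²`-projection exist. -/

theorem integrableOn_dot (u w : PW ι) (K : ι) :
    IntegrableOn (fun x => evalAt u K x ⬝ᵥ evalAt w K x) (T.mesh.cell K).carrier := by
  refine ContinuousOn.integrableOn_compact (T.mesh.cell K).isCompact (Continuous.continuousOn ?_)
  unfold evalAt dotProduct
  exact continuous_finsetSum _ fun l _ =>
    (MvPolynomial.continuous_eval _).mul (MvPolynomial.continuous_eval _)

theorem eq_zero_of_integral (u : PW ι) (K : ι)
    (h : ∫ x in (T.mesh.cell K).carrier, evalAt u K x ⬝ᵥ evalAt u K x = 0) : u K = 0 := by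
  set S := (T.mesh.cell K).carrier with hS
  have hc : ∀ l, Continuous fun x : Pt => MvPolynomial.eval x (u K l) :=
    fun l => MvPolynomial.continuous_eval _
  have hcont : Continuous fun x => evalAt u K x ⬝ᵥ evalAt u K x := by
    unfold evalAt dotProduct
    exact continuous_finsetSum _ fun l _ => (hc l).mul (hc l)
  rw [setIntegral_eq_zero_iff_of_nonneg_ae
    (Eventually.of_forall fun x => by
      simp only [Pi.zero_apply]
      exact Finset.sum_nonneg fun l _ => mul_self_nonneg _) (T.integrableOn_dot u u K)] at h
  have h2 := Measure.eqOn_of_ae_eq h hcont.continuousOn continuousOn_const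
    (by rw [(T.mesh.cell K).regular])
  have hne : (interior S).Nonempty := by
    by_contra hne
    rw [not_nonempty_iff_eq_empty] at hne
    have h3 := (T.mesh.cell K).regular
    have h4 := (T.mesh.cell K).frontier_eq
    rw [← hS] at h3 h4
    rw [hne, closure_empty] at h3
    rw [← h3, frontier_empty] at h4
    have h5 : (T.mesh.cell K).vertex ⟨0, by have := (T.mesh.cell K).three_le; omega⟩ ∈
        (∅ : Set Pt) := by
      rw [h4]
      exact mem_iUnion.2 ⟨_, left_mem_segment ℝ _ _⟩
    exact h5
  obtain ⟨x, hx⟩ := hne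
  obtain ⟨r, hr, hb⟩ := Metric.isOpen_iff.1 isOpen_interior x hx
  rw [ball_pi _ hr] at hb
  funext l
  refine MvPolynomial.funext_set (fun i => Metric.ball (x i) r) (fun i => ?_) fun y hy => ?_
  · rw [Real.ball_eq_Ioo]
    exact Ioo_infinite (by linarith)
  · have h3 := h2 (interior_subset (hb hy))
    have h4 := (dotProduct_self_eq_zero).1 h3
    simpa [evalAt] using congrFun h4 l

instance finite_divFreeSpace [Finite ι] : Module.Finite ℝ (divFreeSpace ι k) := by
  let f : (ι → Fin 8 → MvPolynomial.restrictTotalDegree (Fin 2) ℝ k) →ₗ[ℝ] PW ι :=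
    { toFun := fun g K l => g K l
      map_add' := fun _ _ => rfl
      map_smul' := fun _ _ => rfl }
  have hle : divFreeSpace ι k ≤ LinearMap.range f := fun u hu =>
    ⟨fun K l => ⟨u K l, (hu K).1 l⟩, rfl⟩
  exact Submodule.finiteDimensional_of_le hle

theorem exists_riesz [Fintype ι] (φ : divFreeSpace ι k →ₗ[ℝ] ℝ) :
    ∃ v ∈ divFreeSpace ι k, ∀ w (hw : w ∈ divFreeSpace ι k),
      ∑ K, ∫ x in (T.mesh.cell K).carrier, evalAt v K x ⬝ᵥ evalAt w K x = φ ⟨w, hw⟩ := by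
  let b : divFreeSpace ι k →ₗ[ℝ] divFreeSpace ι k →ₗ[ℝ] ℝ :=
    LinearMap.mk₂ ℝ
      (fun v w => ∑ K, ∫ x in (T.mesh.cell K).carrier, evalAt v.1 K x ⬝ᵥ evalAt w.1 K x)
      (fun u v w => by
        rw [← Finset.sum_add_distrib]
        refine Finset.sum_congr rfl fun K _ => ?_
        rw [← integral_add (T.integrableOn_dot _ _ K) (T.integrableOn_dot _ _ K)]
        congr 1; funext x
        rw [← add_dotProduct]; congr 1; funext l; simp [evalAt])
      (fun c u w => by
        rw [smul_eq_mul, Finset.mul_sum]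
        refine Finset.sum_congr rfl fun K _ => ?_
        rw [← integral_const_mul]
        congr 1; funext x
        rw [← smul_eq_mul, ← smul_dotProduct]; congr 1; funext l; simp [evalAt])
      (fun u v w => by
        rw [← Finset.sum_add_distrib]
        refine Finset.sum_congr rfl fun K _ => ?_
        rw [← integral_add (T.integrableOn_dot _ _ K) (T.integrableOn_dot _ _ K)]
        congr 1; funext x
        rw [← dotProduct_add]; congr 1; funext l; simp [evalAt])
      (fun c u w => by
        rw [smul_eq_mul, Finset.mul_sum]
        refine Finset.sum_congr rfl fun K _ => ?_
        rw [← integral_const_mul]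
        congr 1; funext x
        rw [← smul_eq_mul, ← dotProduct_smul]; congr 1; funext l; simp [evalAt])
  have hinj : Function.Injective b := by
    rw [injective_iff_map_eq_zero]
    intro v hv
    have h : ∑ K, ∫ x in (T.mesh.cell K).carrier, evalAt v.1 K x ⬝ᵥ evalAt v.1 K x = 0 :=
      congrArg (fun g => g v) hv
    rw [Finset.sum_eq_zero_iff_of_nonneg fun K _ => integral_nonneg fun x =>
      Finset.sum_nonneg fun l _ => mul_self_nonneg _] at h
    exact Subtype.ext (funext fun K => T.eq_zero_of_integral v.1 K (h K (Finset.mem_univ K)))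
  have hsurj : Function.Surjective b :=
    (LinearMap.injective_iff_surjective_of_finrank_eq_finrank
      (Subspace.dual_finrank_eq (K := ℝ) (V := divFreeSpace ι k)).symm).1 hinj
  obtain ⟨v, hv⟩ := hsurj φ
  exact ⟨v.1, v.2, fun w hw => congrArg (fun g => g ⟨w, hw⟩) hv⟩

theorem evalAt_add (u w : PW ι) (K : ι) (x : Pt) :
    evalAt (u + w) K x = evalAt u K x + evalAt w K x := by funext l; simp [evalAt]

theorem evalAt_smul (c : ℝ) (u : PW ι) (K : ι) (x : Pt) :
    evalAt (c • u) K x = c • evalAt u K x := by funext l; simp [evalAt]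

theorem weakForm_add (H : ℝ → ℝ → ℝ) (bc : BoundaryRule T) (u : PW ι) (K : ι) (v w : PW ι) :
    T.weakForm H bc u K (v + w) = T.weakForm H bc u K v + T.weakForm H bc u K w := by
  simp only [weakForm, J1, J2, J3, evalAt_add, dotProduct_add, Pi.add_apply, map_add, mul_add,
    Finset.sum_add_distrib]
  ring

theorem weakForm_smul (H : ℝ → ℝ → ℝ) (bc : BoundaryRule T) (u : PW ι) (K : ι) (c : ℝ)
    (w : PW ι) : T.weakForm H bc u K (c • w) = c * T.weakForm H bc u K w := by
  simp only [weakForm, J1, J2, J3, evalAt_smul, dotProduct_smul, Pi.smul_apply,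
    Derivation.map_smul, MvPolynomial.smul_eval, smul_eq_mul, ← mul_add, mul_left_comm _ c, ← Finset.mul_sum]
  ring

theorem exists_isSpatialOperator [Fintype ι] (H : ℝ → ℝ → ℝ) (bc : BoundaryRule T) (u : PW ι) :
    ∃ L, T.IsSpatialOperator H bc u L := by
  classical
  let φ : divFreeSpace ι k →ₗ[ℝ] ℝ :=
    { toFun := fun w => ∑ K, T.weakForm H bc u K w.1
      map_add' := fun v w => by simp [weakForm_add, Finset.sum_add_distrib]
      map_smul' := fun c w => by simp [weakForm_smul, Finset.mul_sum] }
  obtain ⟨L, hL, h⟩ := T.exists_riesz φ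
  refine ⟨L, hL, fun K w hw => ?_⟩
  have hw' : Pi.single K (w K) ∈ divFreeSpace ι k := fun K' => by
    by_cases hK : K' = K
    · subst hK; simpa using hw K'
    · simp [hK]
  have hev : ∀ x, evalAt (Pi.single K (w K) : PW ι) K x = evalAt w K x := fun x => by
    funext l
    simp only [evalAt, Pi.single_eq_same]
  have h1 := h _ hw'
  have h2 : φ ⟨_, hw'⟩ = T.weakForm H bc u K w := by
    change ∑ K', T.weakForm H bc u K' (Pi.single K (w K)) = _
    rw [Finset.sum_eq_single K]
    · simp only [weakForm, J1, J2, J3, hev, Pi.single_eq_same]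
    · intro K' _ hK
      simp [weakForm, J1, J2, J3, evalAt, hK, dotProduct]
    · simp
  rw [h2, Finset.sum_eq_single K] at h1
  · simpa only [hev] using h1
  · intro K' _ hK
    simp [evalAt, hK, dotProduct]
  · simp

theorem exists_isL2Projection [Fintype ι] (u : Pt → State)
    (hu : ∀ l, MemLp (fun x => u x l) 2 (volume.restrict T.mesh.domain)) :
    ∃ v, T.IsL2Projection u v := by
  have hint : ∀ (w : PW ι) K, IntegrableOn (fun x => u x ⬝ᵥ evalAt w K x)
      (T.mesh.cell K).carrier := fun w K => by
    have hS : volume (T.mesh.cell K).carrier < ⊤ := (T.mesh.cell K).isCompact.measure_lt_top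
    have : IsFiniteMeasure (volume.restrict (T.mesh.cell K).carrier) := ⟨by simpa using hS⟩
    refine integrable_finsetSum _ fun l _ => ?_
    have h1 : Integrable (fun x => u x l) (volume.restrict (T.mesh.cell K).carrier) :=
      ((hu l).mono_measure (Measure.restrict_mono (subset_iUnion
        (fun K => (T.mesh.cell K).carrier) K) le_rfl)).integrable (by norm_num)
    exact IntegrableOn.mul_continuousOn h1 (MvPolynomial.continuous_eval _).continuousOn
      (T.mesh.cell K).isCompact
  let φ : divFreeSpace ι k →ₗ[ℝ] ℝ :=
    { toFun := fun w => ∑ K, ∫ x in (T.mesh.cell K).carrier, u x ⬝ᵥ evalAt w.1 K x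
      map_add' := fun v w => by
        rw [← Finset.sum_add_distrib]
        refine Finset.sum_congr rfl fun K _ => ?_
        rw [← integral_add (hint _ K) (hint _ K)]
        simp [evalAt_add, dotProduct_add]
      map_smul' := fun c w => by
        simp [evalAt_smul, dotProduct_smul, integral_const_mul, Finset.mul_sum] }
  obtain ⟨v, hv, h⟩ := T.exists_riesz φ
  exact ⟨v, hv, h⟩

/-- The operator `L_h`: the function that represents the semidiscrete right-hand side (it exists
by `exists_isSpatialOperator`, and is unique since the `L²` inner product is definite). -/
def Lh (H : ℝ → ℝ → ℝ) (bc : BoundaryRule T) (u : PW ι) : PW ι :=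
  Classical.epsilon (T.IsSpatialOperator H bc u)

/-- The `L²`-projection `P_w` of a square-integrable function (it exists by
`exists_isL2Projection`). -/
def Pw [Fintype ι] (u : Pt → State) : PW ι := Classical.epsilon (T.IsL2Projection u)

/-- The quantity `σ_{K,ℰ,q}(u)`. -/
def sigma (H : ℝ → ℝ → ℝ) (bc : BoundaryRule T) (u : PW ι) (K : ι)
    (j : Fin (T.mesh.cell K).nv) (q : Fin T.edgeRule.Q) : ℝ :=
  1 / 2 * |normalMag ((T.mesh.cell K).normal j) (T.intState u K j q)
        - normalMag ((T.mesh.cell K).normal j) (T.extState bc u K j q)| /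
    √((prim H (T.intState u K j q)).rho * (prim H (T.intState u K j q)).enthalpy H)

/-! ## The scaling limiter -/

/-- `min {1, a / b}`, where the quotient counts as `+∞` if `b = 0`. -/
def clip (a b : ℝ) : ℝ := if b = 0 then 1 else min 1 (a / b)

/-- `θ (P - c) + c`. -/
def scaleTo (θ c : ℝ) (P : MvPolynomial (Fin 2) ℝ) : MvPolynomial (Fin 2) ℝ :=
  MvPolynomial.C θ * (P - MvPolynomial.C c) + MvPolynomial.C c

/-- The minimum of a function over the finite set `𝕊_K`. -/
def critMin (K : ι) (f : Pt → ℝ) : ℝ := sInf (f '' T.critPts K)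

/-- The scaling factor `θ₁` of the density. -/
def theta1 (ε : ℝ) (u : PW ι) (K : ι) : ℝ :=
  clip (T.cellAvg u K 0 - ε) (T.cellAvg u K 0 - T.critMin K fun x => evalAt u K x 0)

/-- First limiting step: only the density is scaled. -/
def hat (ε : ℝ) (u : PW ι) : PW ι := fun K =>
  Function.update (u K) 0 (scaleTo (T.theta1 ε u K) (T.cellAvg u K 0) (u K 0))

/-- The scaling factor `θ₂`. -/
def theta2 (ε : ℝ) (u : PW ι) (K : ι) : ℝ :=
  clip (qFun (T.cellAvg u K) - ε)
    (qFun (T.cellAvg u K) - T.critMin K fun x => qFun (evalAt (T.hat ε u) K x))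

/-- Second limiting step: all components but the magnetic field are scaled. -/
def check (ε : ℝ) (u : PW ι) : PW ι := fun K l =>
  if l = 4 ∨ l = 5 ∨ l = 6 then u K l
  else scaleTo (T.theta2 ε u K) (T.cellAvg u K l) (T.hat ε u K l)

open Classical in
/-- The pointwise factor `θ̃(x)`: a root in `[0, 1)` of
`Ψ_ε((1 - t) Ū_K + t Ǔ_K(x)) = 0` if `Ψ_ε(Ǔ_K(x)) < 0`, and `1` otherwise. -/
def thetaPt (ε : ℝ) (u : PW ι) (K : ι) (x : Pt) : ℝ :=
  if 0 ≤ psiEps ε (evalAt (T.check ε u) K x) then 1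
  else Classical.epsilon fun t : ℝ => t ∈ Ico (0 : ℝ) 1 ∧
    psiEps ε ((1 - t) • T.cellAvg u K + t • evalAt (T.check ε u) K x) = 0

/-- The scaling factor `θ₃`. -/
def theta3 (ε : ℝ) (u : PW ι) (K : ι) : ℝ := T.critMin K (T.thetaPt ε u K)

/-- The limiting operator `Π_h` with threshold `ε`. -/
def limiter (ε : ℝ) (u : PW ι) : PW ι := fun K l =>
  scaleTo (T.theta3 ε u K) (T.cellAvg u K l) (T.check ε u K l)

/-- A rule that selects the threshold `ε` of the limiter: whenever all cell averages of `u` are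
admissible, `ε(u)` is positive and so small that they belong to `𝒢_ε`. -/
def IsThresholdRule (H : ℝ → ℝ → ℝ) (ε : PW ι → ℝ) : Prop :=
  ∀ u ∈ T.weakSet H, 0 < ε u ∧ ∀ K, T.cellAvg u K ∈ AdmEps (ε u)

/-! ## The fully discrete scheme -/

/-- `U n i` (with `n < Nt`, `i ≤ Nr`) are the stages of step `n` of the Runge–Kutta DG scheme
with initial datum `U₀`, Runge–Kutta coefficients `α, β` and step sizes `Δt`;
`U n 0` is the solution at time level `n ≤ Nt`. -/
structure IsRKDGSolution [Fintype ι] (H : ℝ → ℝ → ℝ) (bc : BoundaryRule T) (ε : PW ι → ℝ)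
    (U₀ : Pt → State) (Nr : ℕ) (α β : ℕ → ℕ → ℝ) (Nt : ℕ) (Δt : ℕ → ℝ)
    (U : ℕ → ℕ → PW ι) : Prop where
  initial : U 0 0 = T.limiter (ε (T.Pw U₀)) (T.Pw U₀)
  stage : ∀ n < Nt, ∀ i, 1 ≤ i → i ≤ Nr →
    let V := ∑ l ∈ Finset.range i, α i l • (U n l + (β i l * Δt n) • T.Lh H bc (U n l))
    U n i = T.limiter (ε V) V
  next : ∀ n < Nt, U (n + 1) 0 = U n Nr

/-- The CFL condition; entries of the minimum with `β i l = 0` are `+∞`. -/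
def CFL (H : ℝ → ℝ → ℝ) (bc : BoundaryRule T) (Nr : ℕ) (β : ℕ → ℕ → ℝ) (Nt : ℕ) (Δt : ℕ → ℝ)
    (U : ℕ → ℕ → PW ι) : Prop :=
  ∀ n < Nt, ∀ i, 1 ≤ i → i ≤ Nr → ∀ l < i, β i l ≠ 0 → ∀ K j q,
    Δt n ≤ (T.cellRule K).edgeWeight j q * (T.mesh.cell K).area /
      (β i l * T.edgeRule.weight q * (visc + T.sigma H bc (U n l) K j q) *
        (T.mesh.cell K).len j)

end Discretization

/-- Nonnegative coefficients of an explicit SSP Runge–Kutta method with `Nr` stages, written as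
convex combinations of forward Euler steps. -/
def IsSSPCoeff (Nr : ℕ) (α β : ℕ → ℕ → ℝ) : Prop :=
  ∀ i, 1 ≤ i → i ≤ Nr →
    (∀ l < i, 0 ≤ α i l ∧ 0 ≤ β i l) ∧ ∑ l ∈ Finset.range i, α i l = 1

end RMHD

end

open RMHD

namespace RMHD

noncomputable section

/-! The admissible set is an intersection of half-spaces: `U` is admissible iff `D > 0` and φ(U) =
`nStar v B ⬝ᵥ U + pStar v B` is positive for all `|v| < 1` and all `B` (`mem_adm_iff`). So it is
convex (`convex_adm`), and cell averages can be tested against one affine functional at a time,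
although the primitive variables depend on `U` only implicitly.

Necessity rests on an identity (`Prim.split_eq`): φ, augmented by the fluxes in a direction `a`, is
a hydrodynamic term plus the energy-momentum of an electromagnetic difference field. For `|a| ≤ 1`
the latter is nonnegative by the dominant energy condition, and the former is positive by the
kinetic bound on `H`. For sufficiency, take `v` to be the velocity of the pressureless state with
the same `D, m, B`. Then φ is the energy excess over that state, and a continuity argument in the
enthalpy density produces primitive variables (`pack_mem_adm`).

The flux inequality carries a defect `B_i (v·B)`. The interior traces of the defect sum to zero over
the boundary of a cell: a locally divergence-free polynomial field has a stream function, and the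
edge rule integrates its flux exactly (`PolygonalCell.sum_flux_eq_zero`). What remains is the jump
of the normal field. Together with the source term it is bounded by a multiple of φ/√(ρH)
(`Prim.source_le`), which is the origin of σ in the CFL condition. Writing the cell average by the
auxiliary quadrature, the edge weights absorb all losses under the CFL condition, so a forward Euler
step keeps averages admissible (`euler_mem_adm`).

The limiter preserves averages and the divergence constraint. Since `D ≥ ε`, `q ≥ ε`, `Ψ_ε ≥ 0`
imply admissibility (`admEps_subset_adm`), it also makes the values at the critical points
admissible (`limiter_mem_strongSet`). The averages of the projected datum are those of the datum,
and each stage is a limited convex combination of Euler steps, so an induction finishes the proof.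
-/

theorem IsCausalEOS.kinetic_strict {H : ℝ → ℝ → ℝ} (hH : IsCausalEOS H) {p ρ : ℝ}
    (hp : 0 < p) (hρ : 0 < ρ) : √(1 + p ^ 2 / ρ ^ 2) + p / ρ < H p ρ := by
  refine lt_of_le_of_ne (hH.kinetic p ρ hp hρ) fun heq => ?_
  have hd := (hH.differentiable p ρ hp hρ).hasFDerivAt
  have hpos : 0 < 1 + p ^ 2 / ρ ^ 2 := by positivity
  set r := √(1 + p ^ 2 / ρ ^ 2) with hr
  have hr0 : 0 < r := Real.sqrt_pos.2 hpos
  have hd1 : DifferentiableAt ℝ (fun p' => H p' ρ) p :=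
    (HasFDerivAt.comp (f := fun p' : ℝ => (p', ρ)) p hd
      ((hasFDerivAt_id p).prodMk (hasFDerivAt_const ρ p))).differentiableAt
  have hd2 : DifferentiableAt ℝ (fun ρ' => H p ρ') ρ :=
    (HasFDerivAt.comp (f := fun ρ' : ℝ => (p, ρ')) ρ hd
      ((hasFDerivAt_const p ρ).prodMk (hasFDerivAt_id ρ))).differentiableAt
  have e1 : HasDerivAt (fun p' : ℝ => √(1 + p' ^ 2 / ρ ^ 2) + p' / ρ)
      (2 * p / ρ ^ 2 / (2 * r) + 1 / ρ) p := by
    have h := ((((hasDerivAt_id p).pow 2).div_const (ρ ^ 2)).const_add 1).sqrt hpos.ne'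
    have h' := h.add ((hasDerivAt_id p).div_const ρ)
    exact HasDerivAt.congr_deriv (f := fun p' : ℝ => √(1 + p' ^ 2 / ρ ^ 2) + p' / ρ) h' (by simp [r])
  have e2 : HasDerivAt (fun ρ' : ℝ => √(1 + p ^ 2 / ρ' ^ 2) + p / ρ')
      ((-(p ^ 2 * (2 * ρ)) / (ρ ^ 2) ^ 2) / (2 * r) + -p / ρ ^ 2) ρ := by
    have h := (((hasDerivAt_const ρ (p ^ 2)).div ((hasDerivAt_id ρ).pow 2)
      (pow_ne_zero 2 hρ.ne')).const_add 1).sqrt hpos.ne'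
    have h' := h.add ((hasDerivAt_const ρ p).div (hasDerivAt_id ρ) hρ.ne')
    exact HasDerivAt.congr_deriv (f := fun ρ' : ℝ => √(1 + p ^ 2 / ρ' ^ 2) + p / ρ') h' (by simp [r])
  -- Equality at one point makes it an interior minimum of `H` minus the bound, in each variable
  -- separately, so both partial derivatives of `H` and of the bound agree there.
  have m1 : IsLocalMin (fun p' => H p' ρ - (√(1 + p' ^ 2 / ρ ^ 2) + p' / ρ)) p := by
    filter_upwards [lt_mem_nhds hp] with p' hp'
    have := hH.kinetic p' ρ hp' hρ
    linarith
  have m2 : IsLocalMin (fun ρ' => H p ρ' - (√(1 + p ^ 2 / ρ' ^ 2) + p / ρ')) ρ := by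
    filter_upwards [lt_mem_nhds hρ] with ρ' hρ'
    have := hH.kinetic p ρ' hp hρ'
    linarith
  have z1 := m1.hasDerivAt_eq_zero (hd1.hasDerivAt.sub e1)
  have z2 := m2.hasDerivAt_eq_zero (hd2.hasDerivAt.sub e2)
  have hc := hH.causal p ρ hp hρ
  rw [sub_eq_zero.1 z1, sub_eq_zero.1 z2, ← heq] at hc
  -- The bound √(1+p²/ρ²) + p/ρ satisfies the causality relation with equality, which contradicts
  -- the strict inequality for `H`.
  apply hc.ne
  field_simp
  ring

/-! ### Three-vectors -/

theorem dot_sq_le (a V : Fin 3 → ℝ) : (a ⬝ᵥ V) ^ 2 ≤ (a ⬝ᵥ a) * (V ⬝ᵥ V) := by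
  have := Finset.sum_mul_sq_le_sq_mul_sq Finset.univ a V
  simpa [dotProduct, sq] using this

theorem dot_self_nonneg' (a : Fin 3 → ℝ) : 0 ≤ a ⬝ᵥ a :=
  Finset.sum_nonneg fun i _ => mul_self_nonneg (a i)

/-- A vector in the closed forward cone pairs nonnegatively with causal directions. -/
theorem add_dot_nonneg {A : ℝ} {V a : Fin 3 → ℝ} (hA : 0 ≤ A) (hV : V ⬝ᵥ V ≤ A ^ 2)
    (ha : a ⬝ᵥ a ≤ 1) : 0 ≤ A + a ⬝ᵥ V := by
  have h := dot_sq_le a V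
  have h2 : (a ⬝ᵥ V) ^ 2 ≤ A ^ 2 := by
    nlinarith [dot_self_nonneg' V]
  have := abs_le_of_sq_le_sq' h2 hA
  linarith

/-- The sign of `A` is not assumed: if `A ≤ 0`, Cauchy–Schwarz with `|v| < 1` would contradict
positivity in the single timelike direction `(1, -v)`. So `(A, V)` is in the open forward cone. -/
theorem add_dot_pos {A : ℝ} {V a v : Fin 3 → ℝ} (hAv : 0 < A - v ⬝ᵥ V) (hv : v ⬝ᵥ v < 1)
    (hV : V ⬝ᵥ V < A ^ 2) (ha : a ⬝ᵥ a ≤ 1) : 0 < A + a ⬝ᵥ V := by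
  have hA : 0 < A := by
    by_contra hA
    have h := dot_sq_le v V
    have h2 : (v ⬝ᵥ V) ^ 2 ≤ (-A) ^ 2 := by
      nlinarith [dot_self_nonneg' V]
    have := abs_le_of_sq_le_sq' h2 (by linarith)
    linarith
  have h := dot_sq_le a V
  have h2 : (a ⬝ᵥ V) ^ 2 < A ^ 2 := by
    nlinarith [dot_self_nonneg' V]
  have := abs_lt_of_sq_lt_sq' h2 hA.le
  linarith

/-- The slack is exactly `(v·(u - v))²`, as expanding `1 - v·u = (1 - v·v) - v·(u - v)` shows. -/
theorem one_sub_dot_sq (v u : Fin 3 → ℝ) :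
    (1 - v ⬝ᵥ v) * (1 - u ⬝ᵥ u) + (1 - v ⬝ᵥ v) * ((u - v) ⬝ᵥ (u - v)) ≤ (1 - v ⬝ᵥ u) ^ 2 := by
  have := sq_nonneg (v ⬝ᵥ (u - v))
  have e : (1 - v ⬝ᵥ u) ^ 2 - ((1 - v ⬝ᵥ v) * (1 - u ⬝ᵥ u) +
      (1 - v ⬝ᵥ v) * ((u - v) ⬝ᵥ (u - v))) = (v ⬝ᵥ (u - v)) ^ 2 := by
    simp only [dotProduct, Fin.sum_univ_three, Pi.sub_apply]
    ring
  linarith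

/-! ### The linear functionals that describe the admissible set -/

/-- The coefficient vector `n⋆` of the linear constraint with parameters `v, B`. -/
def nStar (v B : Fin 3 → ℝ) : State :=
  pack (-√(1 - v ⬝ᵥ v)) (-v) (-((1 - v ⬝ᵥ v) • B + (v ⬝ᵥ B) • v)) 1

/-- The magnetic pressure `p⋆` of the linear constraint with parameters `v, B`. -/
def pStar (v B : Fin 3 → ℝ) : ℝ := ((1 - v ⬝ᵥ v) * (B ⬝ᵥ B) + (v ⬝ᵥ B) ^ 2) / 2

/-- The electric field of the frozen-in difference field. -/
def eDiff (v B u C : Fin 3 → ℝ) : Fin 3 → ℝ := u ⨯₃ C - v ⨯₃ B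

/-- Energy density of the electromagnetic field `(e, h)` seen by the observer `u`. -/
def emEnergy (e h u : Fin 3 → ℝ) : ℝ := (e ⬝ᵥ e + h ⬝ᵥ h) / 2 - (e ⨯₃ h) ⬝ᵥ u

/-- Momentum density of the electromagnetic field `(e, h)` seen by the observer `u`. -/
def emMomentum (e h u : Fin 3 → ℝ) : Fin 3 → ℝ :=
  e ⨯₃ h - ((e ⬝ᵥ e + h ⬝ᵥ h) / 2) • u + (e ⬝ᵥ u) • e + (h ⬝ᵥ u) • h

/-- Energy and momentum are, up to signs, the Maxwell stress-energy tensor contracted with `(1, u)`.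
The square of that tensor is a multiple of the identity, so the Minkowski norm is that of `(1, u)`
times the field invariants. -/
theorem emEnergy_sq_sub (e h u : Fin 3 → ℝ) :
    emEnergy e h u ^ 2 - emMomentum e h u ⬝ᵥ emMomentum e h u
      = (1 - u ⬝ᵥ u) * (((e ⬝ᵥ e - h ⬝ᵥ h) / 2) ^ 2 + (e ⬝ᵥ h) ^ 2) := by
  simp only [emEnergy, emMomentum, dotProduct, Fin.sum_univ_three, cross_apply, Pi.sub_apply,
    Pi.add_apply, Pi.smul_apply, smul_eq_mul, Matrix.cons_val]
  ring

theorem emEnergy_nonneg (e h u : Fin 3 → ℝ) (hu : u ⬝ᵥ u ≤ 1) : 0 ≤ emEnergy e h u := by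
  have e1 : (e ⬝ᵥ e + h ⬝ᵥ h) / 2 - (e ⨯₃ h) ⬝ᵥ u
      = (h - u ⨯₃ e) ⬝ᵥ (h - u ⨯₃ e) / 2 + ((1 - u ⬝ᵥ u) * (e ⬝ᵥ e) + (u ⬝ᵥ e) ^ 2) / 2 := by
    simp only [dotProduct, Fin.sum_univ_three, cross_apply, Pi.sub_apply, Matrix.cons_val]
    ring
  rw [emEnergy, e1]
  have h1 := dot_self_nonneg' (h - u ⨯₃ e)
  have h2 := mul_nonneg (sub_nonneg.2 hu) (dot_self_nonneg' e)
  positivity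

/-- Dominant energy condition: the observed energy-momentum lies in the closed forward cone. -/
theorem em_nonneg (e h u a : Fin 3 → ℝ) (hu : u ⬝ᵥ u ≤ 1) (ha : a ⬝ᵥ a ≤ 1) :
    0 ≤ emEnergy e h u + a ⬝ᵥ emMomentum e h u := by
  refine add_dot_nonneg (emEnergy_nonneg e h u hu) ?_ ha
  have h1 := emEnergy_sq_sub e h u
  have h2 : 0 ≤ (1 - u ⬝ᵥ u) * (((e ⬝ᵥ e - h ⬝ᵥ h) / 2) ^ 2 + (e ⬝ᵥ h) ^ 2) :=
    mul_nonneg (sub_nonneg.2 hu) (by positivity)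
  linarith

/-! ### Flux splitting and source estimate for a single state -/

namespace Prim

variable {H : ℝ → ℝ → ℝ} {w : Prim}

theorem Physical.dot_lt_one (hw : w.Physical H) : w.v ⬝ᵥ w.v < 1 := by
  have h := hw.2.2.2
  rw [Real.sqrt_lt' one_pos] at h
  simpa using h

theorem Physical.lorentz_pos (hw : w.Physical H) : 0 < w.lorentz :=
  one_div_pos.2 (Real.sqrt_pos.2 (sub_pos.2 hw.dot_lt_one))

theorem Physical.lorentz_inv_sq (hw : w.Physical H) : w.lorentz⁻¹ ^ 2 = 1 - w.v ⬝ᵥ w.v := by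
  rw [lorentz, one_div, inv_inv, Real.sq_sqrt (sub_pos.2 hw.dot_lt_one).le]

theorem Physical.lorentz_sq_mul (hw : w.Physical H) :
    w.lorentz ^ 2 * (1 - w.v ⬝ᵥ w.v) = 1 := by
  rw [← hw.lorentz_inv_sq, ← mul_pow, mul_inv_cancel₀ hw.lorentz_pos.ne', one_pow]

/-- Hydrodynamic part of the linear functional. -/
def hydro (H : ℝ → ℝ → ℝ) (w : Prim) (u a : Fin 3 → ℝ) : ℝ :=
  w.rho * w.lorentz * (1 + a ⬝ᵥ w.v) *
      (w.enthalpy H * w.lorentz * (1 - w.v ⬝ᵥ u) - √(1 - u ⬝ᵥ u)) - w.p * (1 + a ⬝ᵥ u)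

/-- All magnetic terms are quadratic in the two fields and assemble into the energy-momentum of
their difference. The corrections `u i * pStar u C` and `B i * (u ⬝ᵥ C)` are precisely what this
completion costs. -/
theorem split_eq (hw : w.Physical H) (u C a : Fin 3 → ℝ) :
    nStar u C ⬝ᵥ w.toCons H + pStar u C
        + ∑ i, a i * (nStar u C ⬝ᵥ w.flux H i + u i * pStar u C - w.B i * (u ⬝ᵥ C))
      = hydro H w u a + (emEnergy (eDiff w.v w.B u C) (w.B - C) u
          + a ⬝ᵥ emMomentum (eDiff w.v w.B u C) (w.B - C) u) := by
  have hW := hw.lorentz_inv_sq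
  obtain ⟨ρ, p, v, B⟩ := w
  simp only [hydro, toCons, flux, mom, pTot, hW]
  -- Once W⁻² is replaced by `1 - v·v`, the identity is polynomial and holds with `W`, the enthalpy
  -- and the square root as independent variables.
  generalize lorentz _ = W
  generalize enthalpy _ _ = h
  simp only [nStar, pStar, pack, emEnergy, emMomentum, eDiff, dotProduct, Fin.sum_univ_three,
    cross_apply, Pi.sub_apply, Pi.add_apply, Pi.neg_apply, Pi.smul_apply, smul_eq_mul,
    Matrix.cons_val, Fin.sum_univ_eight, Pi.single_apply]
  generalize √_ = s
  simp only [Fin.isValue, Fin.reduceEq, if_true, if_false]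
  ring

/-- The frame-independent lower bound for the Lorentz factor of the relative motion. -/
theorem sqrt_le_lorentz_mul (hw : w.Physical H) {u : Fin 3 → ℝ} (hu : u ⬝ᵥ u < 1) :
    √(1 - u ⬝ᵥ u) ≤ w.lorentz * (1 - w.v ⬝ᵥ u) := by
  have hW := hw.lorentz_pos
  have hv := hw.dot_lt_one
  have h1 := one_sub_dot_sq w.v u
  have h2 := mul_nonneg (sub_pos.2 hv).le (dot_self_nonneg' (u - w.v))
  have h3 : 0 < 1 - w.v ⬝ᵥ u := by
    have := dot_sq_le w.v u
    have h4 : (w.v ⬝ᵥ u) ^ 2 < 1 ^ 2 := by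
      nlinarith [dot_self_nonneg' w.v, dot_self_nonneg' u]
    linarith [(abs_lt_of_sq_lt_sq' h4 one_pos.le).2]
  refine Real.sqrt_le_iff.2 ⟨by positivity, ?_⟩
  rw [mul_pow]
  calc 1 - u ⬝ᵥ u = w.lorentz ^ 2 * ((1 - w.v ⬝ᵥ w.v) * (1 - u ⬝ᵥ u)) := by
        rw [← mul_assoc, hw.lorentz_sq_mul, one_mul]
    _ ≤ _ := by gcongr; linarith

/-- The term is `A + a·V` with `(A, V) = ρWg (1, v) - p (1, u)`, so it suffices that this vector is
timelike and forward. In units of ρ its Minkowski square is `g² + x²s² - 2xgY`, with `x = p/ρ`, and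
Y/s is the relative Lorentz factor. -/
theorem hydro_pos (hH : IsCausalEOS H) (hw : w.Physical H) {u a : Fin 3 → ℝ}
    (hu : u ⬝ᵥ u < 1) (ha : a ⬝ᵥ a ≤ 1) : 0 < hydro H w u a := by
  have hρ := hw.1
  have hp := hw.2.1
  have hW := hw.lorentz_pos
  have hW2 := hw.lorentz_sq_mul
  have hY := sqrt_le_lorentz_mul hw hu
  have hs2 := Real.sq_sqrt (sub_pos.2 hu).le
  have hs := Real.sqrt_pos.2 (sub_pos.2 hu)
  set s := √(1 - u ⬝ᵥ u)
  set W := w.lorentz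
  set Y := W * (1 - w.v ⬝ᵥ u) with hYdef
  set x := w.p / w.rho with hx
  have hx0 : 0 < x := by positivity
  have hpx : w.p = w.rho * x := by rw [hx]; field_simp
  set h := w.enthalpy H with hh
  have hk : √(1 + x ^ 2) + x < h := by
    have := hH.kinetic_strict hp hρ
    rwa [← div_pow] at this
  have hr2 : √(1 + x ^ 2) ^ 2 = 1 + x ^ 2 := Real.sq_sqrt (by positivity)
  have hr1 : 1 ≤ √(1 + x ^ 2) := Real.one_le_sqrt.2 (by nlinarith)
  set r := √(1 + x ^ 2)
  set g := h * Y - s with hg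
  have hYpos : 0 < Y := hs.trans_le hY
  have hlow : r * Y - s < g - x * Y := by
    have := mul_lt_mul_of_pos_right hk hYpos
    rw [hg]; linarith
  have hlow0 : 0 ≤ r * Y - s := by nlinarith
  -- As a function of `g - xY` the form is `(g - xY)² - x²(Y² - s²)`. At the value `rY - s` supplied
  -- by the kinetic bound it is the perfect square `(Y - rs)²`, and strictness of that bound makes
  -- it positive.
  have hquad : 0 < g ^ 2 + x ^ 2 * s ^ 2 - 2 * x * g * Y := by
    have h1 : (r * Y - s) ^ 2 < (g - x * Y) ^ 2 := pow_lt_pow_left₀ hlow hlow0 two_ne_zero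
    have h2 : (r * Y - s) ^ 2 - (x ^ 2 * Y ^ 2 - x ^ 2 * s ^ 2) = (Y - r * s) ^ 2 := by
      linear_combination (Y ^ 2 - s ^ 2) * hr2
    linarith [sq_nonneg (Y - r * s)]
  have key : hydro H w u a = (w.rho * W * g - w.p)
      + a ⬝ᵥ ((w.rho * W * g) • w.v - w.p • u) := by
    rw [dotProduct_sub, dotProduct_smul, dotProduct_smul, hydro]
    simp only [smul_eq_mul, hg, hYdef]
    ring
  rw [key]
  refine add_dot_pos (v := w.v) ?_ hw.dot_lt_one ?_ ha
  · rw [dotProduct_sub, dotProduct_smul, dotProduct_smul, hpx]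
    simp only [smul_eq_mul]
    have e : w.rho * W * g - w.rho * x - (w.rho * W * g * w.v ⬝ᵥ w.v - w.rho * x * w.v ⬝ᵥ u)
        = w.rho / W * (g - x * Y) := by
      rw [hYdef]
      field_simp
      linear_combination g * hW2
    rw [e]
    have : 0 < g - x * Y := by linarith
    positivity
  · have e : (w.rho * W * g - w.p) ^ 2 - ((w.rho * W * g) • w.v - w.p • u) ⬝ᵥ
        ((w.rho * W * g) • w.v - w.p • u)
        = w.rho ^ 2 * (g ^ 2 + x ^ 2 * s ^ 2 - 2 * x * g * Y) := by
      simp only [sub_dotProduct, dotProduct_sub, smul_dotProduct, dotProduct_smul, smul_eq_mul]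
      rw [hpx, hs2, hYdef, dotProduct_comm u w.v]
      linear_combination w.rho ^ 2 * g ^ 2 * hW2
    have : 0 < w.rho ^ 2 * (g ^ 2 + x ^ 2 * s ^ 2 - 2 * x * g * Y) := by positivity
    linarith

/-- The generalized Lax–Friedrichs splitting inequality. -/
theorem split_pos (hH : IsCausalEOS H) (hw : w.Physical H) {u a : Fin 3 → ℝ} (C : Fin 3 → ℝ)
    (hu : u ⬝ᵥ u < 1) (ha : a ⬝ᵥ a ≤ 1) :
    0 < nStar u C ⬝ᵥ w.toCons H + pStar u C
        + ∑ i, a i * (nStar u C ⬝ᵥ w.flux H i + u i * pStar u C - w.B i * (u ⬝ᵥ C)) := by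
  rw [split_eq hw]
  have h1 := hydro_pos hH hw hu ha
  have h2 := em_nonneg (eDiff w.v w.B u C) (w.B - C) u a hu.le ha
  linarith

theorem nStar_pos (hH : IsCausalEOS H) (hw : w.Physical H) {u : Fin 3 → ℝ} (C : Fin 3 → ℝ)
    (hu : u ⬝ᵥ u < 1) : 0 < nStar u C ⬝ᵥ w.toCons H + pStar u C := by
  simpa using split_pos hH hw (a := 0) C hu (by simp)

/-- Adding `u·C` leaves an expression bilinear in the difference field and the relative velocity `u
- v` (note `v × u = v × (u - v)`), so it can be absorbed by completing a square. -/
theorem nStar_source (u C : Fin 3 → ℝ) : nStar u C ⬝ᵥ w.source + u ⬝ᵥ C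
    = -((w.B - C) ⬝ᵥ (u - w.v) + eDiff w.v w.B u C ⬝ᵥ (w.v ⨯₃ u)) := by
  simp only [source, nStar, pack, eDiff, dotProduct, Fin.sum_univ_three,
    cross_apply, Pi.sub_apply, Pi.add_apply, Pi.neg_apply, Pi.smul_apply, smul_eq_mul,
    Matrix.cons_val, Fin.sum_univ_eight]
  ring

/-- The mixed term is `κ (u - v)·(h - u × e)`, and `|h - u × e|²/2` is already part of the
electromagnetic energy. The cost `κ²|u - v|²/2` is paid by `hydro_source` when κ² = ρH. -/
theorem emEnergy_source (e h u v : Fin 3 → ℝ) (κ : ℝ) :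
    emEnergy e h u + κ * (h ⬝ᵥ (u - v) + e ⬝ᵥ (v ⨯₃ u)) + κ ^ 2 * ((u - v) ⬝ᵥ (u - v)) / 2
      = (h - u ⨯₃ e + κ • (u - v)) ⬝ᵥ (h - u ⨯₃ e + κ • (u - v)) / 2
        + ((1 - u ⬝ᵥ u) * (e ⬝ᵥ e) + (u ⬝ᵥ e) ^ 2) / 2 := by
  simp only [emEnergy, dotProduct, Fin.sum_univ_three,
    cross_apply, Pi.sub_apply, Pi.add_apply, Pi.smul_apply, smul_eq_mul, Matrix.cons_val]
  ring

theorem hydro_source (hH : IsCausalEOS H) (hw : w.Physical H) {u : Fin 3 → ℝ}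
    (hu : u ⬝ᵥ u < 1) :
    w.rho * w.enthalpy H * ((u - w.v) ⬝ᵥ (u - w.v)) / 2 ≤ hydro H w u 0 := by
  have hρ := hw.1
  have hp := hw.2.1
  have hW2 := hw.lorentz_sq_mul
  have hs2 := Real.sq_sqrt (sub_pos.2 hu).le
  simp only [hydro, zero_dotProduct, add_zero, mul_one]
  set s := √(1 - u ⬝ᵥ u)
  set W := w.lorentz
  set x := w.p / w.rho with hx
  have hx0 : 0 < x := by positivity
  have hpx : w.p = w.rho * x := by rw [hx]; field_simp
  set h := w.enthalpy H with hh
  have hk : √(1 + x ^ 2) + x ≤ h := by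
    have := hH.kinetic _ _ hp hρ
    rwa [← div_pow] at this
  have hr2 : √(1 + x ^ 2) ^ 2 = 1 + x ^ 2 := Real.sq_sqrt (by positivity)
  have hr1 : 1 ≤ √(1 + x ^ 2) := Real.one_le_sqrt.2 (by nlinarith)
  set r := √(1 + x ^ 2)
  have hδ : (u - w.v) ⬝ᵥ (u - w.v) = u ⬝ᵥ u - 2 * w.v ⬝ᵥ u + w.v ⬝ᵥ w.v := by
    simp only [sub_dotProduct, dotProduct_sub, dotProduct_comm u w.v]
    ring
  -- Twice the claim divided by ρ is `h` times this nonnegative remainder plus `h(1 + (Ws)²) - 2Ws -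
  -- 2x`. Multiplied by `h`, the latter is `(hWs - 1)² + h(h - 2x) - 1`, and `h(h - 2x) ≥ (r + x)(r
  -- - x) = 1`.
  have hA : 2 * (W ^ 2 * (1 - w.v ⬝ᵥ u)) - (u - w.v) ⬝ᵥ (u - w.v) - (1 + (W * s) ^ 2)
      = (w.v ⬝ᵥ w.v) * W ^ 2 * ((u - w.v) ⬝ᵥ (u - w.v)) := by
    rw [hδ, mul_pow, hs2]
    linear_combination (w.v ⬝ᵥ w.v + u ⬝ᵥ u - 2 * w.v ⬝ᵥ u + 1) * hW2
  have hA0 : 0 ≤ (w.v ⬝ᵥ w.v) * W ^ 2 * ((u - w.v) ⬝ᵥ (u - w.v)) :=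
    mul_nonneg (mul_nonneg (dot_self_nonneg' _) (sq_nonneg _)) (dot_self_nonneg' _)
  have hh0 : 0 < h := by linarith
  have h1 : 1 ≤ h * (h - 2 * x) := by
    have h2 : r - x ≤ h - 2 * x := by linarith
    have h3 : 0 ≤ r - x := by nlinarith
    nlinarith [mul_le_mul hk h2 h3 hh0.le]
  have h4 : 0 ≤ h * (1 + (W * s) ^ 2) - 2 * (W * s) - 2 * x := by
    refine nonneg_of_mul_nonneg_right ?_ hh0
    nlinarith [sq_nonneg (h * (W * s) - 1)]
  have h5 : 0 ≤ w.rho * (h * (1 + (W * s) ^ 2) - 2 * (W * s) - 2 * x) := by positivity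
  have h6 : 0 ≤ w.rho * h * ((w.v ⬝ᵥ w.v) * W ^ 2 * ((u - w.v) ⬝ᵥ (u - w.v))) := by positivity
  rw [← hA] at h6
  rw [hpx]
  linarith

theorem source_le (hH : IsCausalEOS H) (hw : w.Physical H) {u : Fin 3 → ℝ} (C : Fin 3 → ℝ)
    (hu : u ⬝ᵥ u < 1) :
    √(w.rho * w.enthalpy H) * |nStar u C ⬝ᵥ w.source + u ⬝ᵥ C|
      ≤ nStar u C ⬝ᵥ w.toCons H + pStar u C := by
  have hsplit := split_eq hw u C 0
  simp only [Pi.zero_apply, zero_mul, Finset.sum_const_zero, add_zero, zero_dotProduct] at hsplit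
  rw [hsplit, nStar_source, abs_neg]
  have hh0 : 0 ≤ w.rho * w.enthalpy H := by
    have h := hH.kinetic _ _ hw.2.1 hw.1
    have h2 : 0 < w.p / w.rho := div_pos hw.2.1 hw.1
    have h3 : 0 ≤ w.enthalpy H := (add_nonneg (Real.sqrt_nonneg _) h2.le).trans h
    exact mul_nonneg hw.1.le h3
  have hκ := Real.sq_sqrt hh0
  have hy := hydro_source hH hw hu
  -- The completed square is valid for both signs of κ, and the two choices together bound the
  -- absolute value.
  have hgen : ∀ κ : ℝ, κ ^ 2 = w.rho * w.enthalpy H →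
      -(κ * ((w.B - C) ⬝ᵥ (u - w.v) + eDiff w.v w.B u C ⬝ᵥ (w.v ⨯₃ u))) ≤ hydro H w u 0 +
        emEnergy (eDiff w.v w.B u C) (w.B - C) u := by
    intro κ hκ
    have h1 := emEnergy_source (eDiff w.v w.B u C) (w.B - C) u w.v κ
    rw [hκ] at h1
    have h2 := dot_self_nonneg' ((w.B - C) - u ⨯₃ (eDiff w.v w.B u C) + κ • (u - w.v))
    have h3 := mul_nonneg (sub_pos.2 hu).le (dot_self_nonneg' (eDiff w.v w.B u C))
    have h4 := sq_nonneg (u ⬝ᵥ eDiff w.v w.B u C)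
    linarith
  have hp := hgen _ hκ
  have hm := hgen (-√(w.rho * w.enthalpy H)) (by rw [neg_sq, hκ])
  rcases abs_cases ((w.B - C) ⬝ᵥ (u - w.v) + eDiff w.v w.B u C ⬝ᵥ (w.v ⨯₃ u)) with h | h <;>
    rw [h.1] <;> linarith

end Prim

/-! ### Recovery of primitive variables -/

namespace IsCausalEOS

variable {H : ℝ → ℝ → ℝ}

theorem one_add_lt (hH : IsCausalEOS H) {p ρ : ℝ} (hp : 0 < p) (hρ : 0 < ρ) :
    1 + p / ρ < H p ρ := by
  have h := hH.kinetic_strict hp hρ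
  have h1 : 1 ≤ √(1 + p ^ 2 / ρ ^ 2) := Real.one_le_sqrt.2 (by simp; positivity)
  linarith

theorem continuousOn_left (hH : IsCausalEOS H) {ρ : ℝ} (hρ : 0 < ρ) :
    ContinuousOn (fun p => H p ρ) (Ioi 0) := fun p hp =>
  (ContinuousAt.comp (f := fun p : ℝ => (p, ρ)) (hH.differentiable p ρ hp hρ).continuousAt
    (by fun_prop)).continuousWithinAt

theorem continuousAt_right (hH : IsCausalEOS H) {p ρ : ℝ} (hp : 0 < p) (hρ : 0 < ρ) :
    ContinuousAt (fun ρ => H p ρ) ρ :=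
  ContinuousAt.comp (f := fun ρ : ℝ => (p, ρ)) (hH.differentiable p ρ hp hρ).continuousAt
    (by fun_prop)

/-- Causality and `∂H/∂ρ < 0` force `∂H/∂p > 1/ρ`. -/
theorem strictMonoOn_left (hH : IsCausalEOS H) {ρ : ℝ} (hρ : 0 < ρ) :
    StrictMonoOn (fun p => H p ρ) (Ioi 0) := by
  refine strictMonoOn_of_deriv_pos (convex_Ioi 0) (hH.continuousOn_left hρ) fun p hp => ?_
  rw [interior_Ioi] at hp
  have h1 := (hH.causal p ρ hp hρ).trans (hH.expansion p ρ hp hρ)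
  have h2 : 0 < p / ρ := div_pos hp hρ
  have h3 := hH.one_add_lt hp hρ
  have h4 : 1 / ρ - deriv (fun p' => H p' ρ) p < 0 := by
    by_contra h
    exact absurd h1 (not_lt.2 (mul_nonneg (by linarith) (not_lt.1 h)))
  have h5 : 0 < 1 / ρ := by positivity
  linarith

/-- The cold limit supplies values below `h`, and `H > 1 + p/ρ` supplies values above. -/
theorem exists_pressure (hH : IsCausalEOS H) {ρ h : ℝ} (hρ : 0 < ρ) (hh : 1 < h) :
    ∃ p, 0 < p ∧ H p ρ = h := by
  obtain ⟨p₀, h1, hp₀⟩ := (((hH.cold ρ hρ).eventually (gt_mem_nhds hh)).and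
    self_mem_nhdsWithin).exists
  have hp₀' : 0 < p₀ := hp₀
  have hle : p₀ ≤ max p₀ (ρ * h) := le_max_left _ _
  have h2 : h ≤ H (max p₀ (ρ * h)) ρ := by
    have h3 := hH.one_add_lt (hp₀'.trans_le hle) hρ
    have h4 : h ≤ max p₀ (ρ * h) / ρ := by
      rw [le_div_iff₀ hρ, mul_comm]
      exact le_max_right _ _
    linarith
  obtain ⟨p, hp, rfl⟩ := intermediate_value_Icc hle
    ((hH.continuousOn_left hρ).mono fun p hp => hp₀'.trans_le hp.1) ⟨h1.le, h2⟩
  exact ⟨p, hp₀'.trans_le hp.1, rfl⟩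

/-- The kinetic bound solved for the pressure, using `(r + x)(r - x) = 1`. It forces `p → 0` as `H →
1` and keeps the energy coercive in `pack_mem_adm`. -/
theorem pressure_le (hH : IsCausalEOS H) {p ρ : ℝ} (hp : 0 < p) (hρ : 0 < ρ) :
    p ≤ ρ * (H p ρ - 1 / H p ρ) / 2 := by
  have h := hH.kinetic p ρ hp hρ
  rw [← div_pow] at h
  have hx : 0 < p / ρ := div_pos hp hρ
  have hpx : p = ρ * (p / ρ) := by field_simp
  set x := p / ρ
  have hr2 : √(1 + x ^ 2) ^ 2 = 1 + x ^ 2 := Real.sq_sqrt (by positivity)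
  have hr0 := Real.sqrt_nonneg (1 + x ^ 2)
  set r := √(1 + x ^ 2)
  have hH0 : 0 < H p ρ := by linarith
  have h1 : 0 < r + x := by linarith
  have h2 : 1 / H p ρ ≤ r - x := by
    rw [div_le_iff₀ hH0]
    have h3 : 0 ≤ r - x := by nlinarith
    nlinarith [mul_le_mul_of_nonneg_left h h3]
  have h3 : x ≤ (H p ρ - 1 / H p ρ) / 2 := by linarith
  calc p = ρ * x := hpx
    _ ≤ ρ * ((H p ρ - 1 / H p ρ) / 2) := by gcongr
    _ = _ := by ring

end IsCausalEOS

/-- The velocity of a state with momentum `m`, magnetic field `B` and enthalpy density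
`ξ = ρ H W²`. -/
def velOf (m B : Fin 3 → ℝ) (ξ : ℝ) : Fin 3 → ℝ := (ξ + B ⬝ᵥ B)⁻¹ • (m + (m ⬝ᵥ B / ξ) • B)

/-- The function whose positive zero is the enthalpy density of the pressureless state. -/
def coldFun (D : ℝ) (m B : Fin 3 → ℝ) (ξ : ℝ) : ℝ :=
  1 - velOf m B ξ ⬝ᵥ velOf m B ξ - D ^ 2 / ξ ^ 2

/-- The coefficient `D² |B|² + (m·B)²`. -/
def magCoeff (D : ℝ) (m B : Fin 3 → ℝ) : ℝ := D ^ 2 * (B ⬝ᵥ B) + (m ⬝ᵥ B) ^ 2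

section

variable {D ξ : ℝ} {m B : Fin 3 → ℝ}

theorem magCoeff_nonneg (D : ℝ) (m B : Fin 3 → ℝ) : 0 ≤ magCoeff D m B := by
  have := dot_self_nonneg' B
  unfold magCoeff; positivity

theorem velOf_dot_mag (hξ : 0 < ξ) : velOf m B ξ ⬝ᵥ B = m ⬝ᵥ B / ξ := by
  have hb := dot_self_nonneg' B
  have : ξ + B ⬝ᵥ B ≠ 0 := by positivity
  simp only [velOf, smul_dotProduct, add_dotProduct, smul_eq_mul]
  field_simp

theorem velOf_dot_self (hξ : 0 < ξ) : velOf m B ξ ⬝ᵥ velOf m B ξ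
    = (m ⬝ᵥ m) / (ξ + B ⬝ᵥ B) ^ 2
      + (m ⬝ᵥ B) ^ 2 * (2 * ξ + B ⬝ᵥ B) / (ξ ^ 2 * (ξ + B ⬝ᵥ B) ^ 2) := by
  have hb := dot_self_nonneg' B
  have : ξ + B ⬝ᵥ B ≠ 0 := by positivity
  simp only [velOf, smul_dotProduct, add_dotProduct, dotProduct_smul, dotProduct_add, smul_eq_mul,
    dotProduct_comm B m]
  field_simp
  ring

theorem coldFun_mul (hξ : 0 < ξ) : ξ ^ 2 * (ξ + B ⬝ᵥ B) ^ 2 * coldFun D m B ξ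
    = ξ ^ 2 * ((ξ + B ⬝ᵥ B) ^ 2 - (D ^ 2 + m ⬝ᵥ m))
      - (2 * ξ + B ⬝ᵥ B) * magCoeff D m B := by
  have hb := dot_self_nonneg' B
  have : ξ + B ⬝ᵥ B ≠ 0 := by positivity
  rw [coldFun, velOf_dot_self hξ, magCoeff]
  field_simp
  ring

/-- In this form only reciprocals of ξ and ξ + |B|² occur, with nonpositive coefficients, so
monotonicity in ξ can be read off. -/
theorem coldFun_eq (hξ : 0 < ξ) : coldFun D m B ξ
    = 1 - (D ^ 2 + m ⬝ᵥ m) * ((ξ + B ⬝ᵥ B)⁻¹) ^ 2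
      - magCoeff D m B * (ξ⁻¹ * (ξ + B ⬝ᵥ B)⁻¹ * (ξ⁻¹ + (ξ + B ⬝ᵥ B)⁻¹)) := by
  have hb := dot_self_nonneg' B
  have : ξ + B ⬝ᵥ B ≠ 0 := by positivity
  rw [coldFun, velOf_dot_self hξ, magCoeff]
  field_simp
  ring

theorem coldFun_strictMonoOn (hD : 0 < D) : StrictMonoOn (coldFun D m B) (Ioi 0) := by
  intro ξ (hξ : 0 < ξ) η (hη : 0 < η) h
  have hb := dot_self_nonneg' B
  have hM : 0 < D ^ 2 + m ⬝ᵥ m := by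
    have := dot_self_nonneg' m
    positivity
  have hL := magCoeff_nonneg D m B
  rw [coldFun_eq hξ, coldFun_eq hη]
  have h1 : (D ^ 2 + m ⬝ᵥ m) * ((η + B ⬝ᵥ B)⁻¹) ^ 2
      < (D ^ 2 + m ⬝ᵥ m) * ((ξ + B ⬝ᵥ B)⁻¹) ^ 2 := by gcongr
  have h2 : magCoeff D m B * (η⁻¹ * (η + B ⬝ᵥ B)⁻¹ * (η⁻¹ + (η + B ⬝ᵥ B)⁻¹))
      ≤ magCoeff D m B * (ξ⁻¹ * (ξ + B ⬝ᵥ B)⁻¹ * (ξ⁻¹ + (ξ + B ⬝ᵥ B)⁻¹)) := by gcongr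
  linarith

theorem continuousOn_velSq :
    ContinuousOn (fun ξ => velOf m B ξ ⬝ᵥ velOf m B ξ) (Ioi 0) := by
  have hb := dot_self_nonneg' B
  have h : ContinuousOn (fun ξ : ℝ => (m ⬝ᵥ m) / (ξ + B ⬝ᵥ B) ^ 2
      + (m ⬝ᵥ B) ^ 2 * (2 * ξ + B ⬝ᵥ B) / (ξ ^ 2 * (ξ + B ⬝ᵥ B) ^ 2)) (Ioi 0) := by
    refine ContinuousOn.add (ContinuousOn.div (by fun_prop) (by fun_prop) fun ξ hξ => ?_)
      (ContinuousOn.div (by fun_prop) (by fun_prop) fun ξ hξ => ?_)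
    all_goals
      have : 0 < ξ := hξ
      positivity
  exact h.congr fun ξ hξ => velOf_dot_self hξ

theorem continuousOn_coldFun : ContinuousOn (coldFun D m B) (Ioi 0) := by
  refine (continuousOn_const.sub continuousOn_velSq).sub
    (ContinuousOn.div (by fun_prop) (by fun_prop) fun ξ hξ => ?_)
  exact pow_ne_zero 2 (ne_of_gt hξ)

theorem exists_coldFun_eq_zero (hD : 0 < D) (m B : Fin 3 → ℝ) :
    ∃ ξ, 0 < ξ ∧ coldFun D m B ξ = 0 := by
  have hm := dot_self_nonneg' m
  have hb := dot_self_nonneg' B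
  have hM : 0 < D ^ 2 + m ⬝ᵥ m := by positivity
  have hMs := Real.sq_sqrt hM.le
  have hM0 := Real.sqrt_pos.2 hM
  have hDM : D ≤ √(D ^ 2 + m ⬝ᵥ m) := Real.le_sqrt_of_sq_le (by linarith)
  -- The zero is bracketed by `D` and `√(D² + |m|²)`. At the right end Cauchy–Schwarz gives
  -- `magCoeff ≤ M²|B|²`, exactly what is needed for a nonnegative value.
  have h1 : coldFun D m B D ≤ 0 := by
    have := dot_self_nonneg' (velOf m B D)
    rw [coldFun, div_self (pow_ne_zero 2 hD.ne')]
    linarith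
  have h2 : 0 ≤ coldFun D m B √(D ^ 2 + m ⬝ᵥ m) := by
    set M := √(D ^ 2 + m ⬝ᵥ m)
    refine nonneg_of_mul_nonneg_right (b := coldFun D m B M)
      (a := M ^ 2 * (M + B ⬝ᵥ B) ^ 2) ?_ (by positivity)
    rw [coldFun_mul hM0]
    have hc := dot_sq_le m B
    have h3 : magCoeff D m B ≤ M ^ 2 * (B ⬝ᵥ B) := by
      rw [magCoeff, hMs]; linarith
    have h4 : (2 * M + B ⬝ᵥ B) * magCoeff D m B ≤ (2 * M + B ⬝ᵥ B) * (M ^ 2 * (B ⬝ᵥ B)) := by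
      gcongr
    rw [← hMs]
    nlinarith
  obtain ⟨ξ, hξ, h⟩ := intermediate_value_Icc hDM
    (continuousOn_coldFun.mono fun ξ hξ => hD.trans_le hξ.1) ⟨h1, h2⟩
  exact ⟨ξ, hD.trans_le hξ.1, h⟩

/-- A state whose energy exceeds the energy of the pressureless state with the same density,
momentum and magnetic field is admissible. -/
theorem pack_mem_adm {H : ℝ → ℝ → ℝ} (hH : IsCausalEOS H) {E : ℝ} (hD : 0 < D) (hξ : 0 < ξ)
    (hcold : coldFun D m B ξ = 0)
    (hE : ξ + B ⬝ᵥ B - magCoeff D m B / (2 * ξ ^ 2) < E) : pack D m B E ∈ Adm H := by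
  have hb := dot_self_nonneg' B
  set f : ℝ → ℝ := fun η => velOf m B η ⬝ᵥ velOf m B η with hf
  set N : ℝ → ℝ := fun η => √(1 - f η) with hN
  have hge : ∀ η, ξ ≤ η → D ^ 2 / η ^ 2 ≤ 1 - f η := fun η h => by
    have := (coldFun_strictMonoOn (m := m) (B := B) hD).monotoneOn hξ (hξ.trans_le h) h
    rw [hcold, coldFun] at this
    simp only [hf]; linarith
  have hgt : ∀ η, ξ < η → D ^ 2 / η ^ 2 < 1 - f η := fun η h => by
    have := coldFun_strictMonoOn (m := m) (B := B) hD hξ (hξ.trans h) h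
    rw [hcold, coldFun] at this
    simp only [hf]; linarith
  have hpos : ∀ η, ξ ≤ η → 0 < 1 - f η := fun η h =>
    (by have := hξ.trans_le h; positivity : 0 < D ^ 2 / η ^ 2).trans_le (hge η h)
  have hNpos : ∀ η, ξ ≤ η → 0 < N η := fun η h => Real.sqrt_pos.2 (hpos η h)
  have hNsq : ∀ η, ξ ≤ η → N η ^ 2 = 1 - f η := fun η h => Real.sq_sqrt (hpos η h).le
  have hfc : ContinuousOn f (Ici ξ) := continuousOn_velSq.mono fun η hη => hξ.trans_le hη
  have hNc : ContinuousOn N (Ici ξ) := (continuousOn_const.sub hfc).sqrt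
  -- The unknown is η = ρHW². With ρ = `D N` and `W = 1/N`, this relation forces the specific
  -- enthalpy `η N / D`, which exceeds 1 exactly when η is beyond the cold value ξ.
  set h : ℝ → ℝ := fun η => η * N η / D with hh
  have hhc : ContinuousOn h (Ici ξ) := (continuousOn_id.mul hNc).div_const D
  have hNξ : N ξ = D / ξ := by
    rw [hN]
    have : 1 - f ξ = (D / ξ) ^ 2 := by
      rw [coldFun] at hcold
      simp only [hf, div_pow]; linarith
    simp only [this]
    exact Real.sqrt_sq (by positivity)
  have hhξ : h ξ = 1 := by
    simp only [hh, hNξ]; field_simp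
  have hh1 : ∀ η, ξ < η → 1 < h η := fun η hη => by
    have hη0 := hξ.trans hη
    have h1 : D / η < N η := by
      refine lt_of_pow_lt_pow_left₀ 2 (hNpos η hη.le).le ?_
      rw [div_pow, hNsq η hη.le]
      exact hgt η hη
    simp only [hh]
    rw [lt_div_iff₀ hD, one_mul]
    rwa [div_lt_iff₀ hη0, mul_comm] at h1
  -- The pressure is given its limit value 0 at ξ, so that the intermediate value theorem can start
  -- at the pressureless state.
  have hex : ∀ η, ∃ p, (ξ < η → 0 < p ∧ H p (D * N η) = h η) ∧ (¬ ξ < η → p = 0) := fun η => by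
    by_cases hη : ξ < η
    · obtain ⟨p, hp⟩ := hH.exists_pressure (mul_pos hD (hNpos η hη.le)) (hh1 η hη)
      exact ⟨p, fun _ => hp, fun h' => absurd hη h'⟩
    · exact ⟨0, fun h' => absurd h' hη, fun _ => rfl⟩
  choose P hP hP0 using hex
  have hPξ : P ξ = 0 := hP0 ξ (lt_irrefl ξ)
  have hPnn : ∀ η, 0 ≤ P η := fun η => by
    by_cases hη : ξ < η
    · exact (hP η hη).1.le
    · exact (hP0 η hη).ge
  have hPle : ∀ η, ξ ≤ η → P η ≤ D * N η * (h η - 1 / h η) / 2 := fun η hη => by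
    rcases hη.eq_or_lt with rfl | hη'
    · rw [hPξ, hhξ]; norm_num
    · have := hH.pressure_le (hP η hη').1 (mul_pos hD (hNpos η hη))
      rwa [(hP η hη').2] at this
  -- At ξ continuity follows by squeezing between 0 and the bound of `pressure_le`. Beyond ξ, strict
  -- monotonicity of `H` in `p` turns comparisons of pressures into comparisons of enthalpies, which
  -- are open conditions in η.
  have hPc : ContinuousOn P (Ici ξ) := by
    intro η hη
    rcases (show ξ ≤ η from hη).eq_or_lt with rfl | hη'
    · have hub : ContinuousWithinAt (fun η => D * N η * (h η - 1 / h η) / 2) (Ici ξ) ξ :=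
        (((continuousOn_const.mul hNc) ξ hη).mul ((hhc ξ hη).sub
          (continuousWithinAt_const.div (hhc ξ hη) (by rw [hhξ]; norm_num)))).div_const 2
      have hub' := hub.tendsto
      simp only [hhξ] at hub'
      norm_num at hub'
      rw [ContinuousWithinAt, hPξ]
      exact tendsto_of_tendsto_of_tendsto_of_le_of_le' tendsto_const_nhds
        (by simpa using hub') (Eventually.of_forall hPnn)
        (by filter_upwards [self_mem_nhdsWithin] with η hη using by simpa using hPle η hη)
    · refine ContinuousAt.continuousWithinAt ?_
      have hnb : Ici ξ ∈ 𝓝 η := Ici_mem_nhds hη'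
      have hNa := hNc.continuousAt hnb
      have hha := hhc.continuousAt hnb
      have hHa : ∀ a, 0 < a → ContinuousAt (fun η => H a (D * N η)) η := fun a ha =>
        ContinuousAt.comp (f := fun η => D * N η) (g := fun ρ => H a ρ)
          (hH.continuousAt_right ha (mul_pos hD (hNpos η hη'.le))) (hNa.const_mul D)
      obtain ⟨hp, hpe⟩ := hP η hη'
      have hmono := hH.strictMonoOn_left (mul_pos hD (hNpos η hη'.le))
      refine tendsto_order.2 ⟨fun a ha => ?_, fun a ha => ?_⟩
      · rcases le_or_gt a 0 with ha0 | ha0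
        · filter_upwards [lt_mem_nhds hη'] with ζ hζ using ha0.trans_lt (hP ζ hζ).1
        · have h1 : H a (D * N η) < h η := by
            rw [← hpe]; exact hmono ha0 hp ha
          filter_upwards [(hHa a ha0).eventually_lt hha h1, lt_mem_nhds hη'] with ζ h2 hζ
          rw [← (hP ζ hζ).2] at h2
          exact ((hH.strictMonoOn_left (mul_pos hD (hNpos ζ hζ.le))).lt_iff_lt ha0
            (hP ζ hζ).1).1 h2
      · have ha0 : 0 < a := hp.trans ha
        have h1 : h η < H a (D * N η) := by
          rw [← hpe]; exact hmono hp ha0 ha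
        filter_upwards [hha.eventually_lt (hHa a ha0) h1, lt_mem_nhds hη'] with ζ h2 hζ
        rw [← (hP ζ hζ).2] at h2
        exact ((hH.strictMonoOn_left (mul_pos hD (hNpos ζ hζ.le))).lt_iff_lt
            (hP ζ hζ).1 ha0).1 h2
  -- The energy of the state reconstructed from η. It equals the pressureless energy at ξ and must
  -- be made equal to `E`.
  set g : ℝ → ℝ := fun η =>
    η - (P η + ((1 - f η) * (B ⬝ᵥ B) + (m ⬝ᵥ B / η) ^ 2) / 2) + B ⬝ᵥ B with hg
  have hgc : ContinuousOn g (Ici ξ) := by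
    refine (continuousOn_id.sub (hPc.add ((((continuousOn_const.sub hfc).mul
      continuousOn_const).add (ContinuousOn.pow (continuousOn_const.div continuousOn_id
        fun η hη => ?_) 2)).div_const 2))).add continuousOn_const
    exact (hξ.trans_le hη).ne'
  have hgξ : g ξ ≤ E := by
    refine le_trans (le_of_eq ?_) hE.le
    have : 1 - f ξ = D ^ 2 / ξ ^ 2 := by
      rw [coldFun] at hcold
      simp only [hf]; linarith
    simp only [hg, hPξ, this, magCoeff]
    field_simp
    ring
  -- The pressure takes away at most `η(1 - f)/2` and the magnetic pressure at most `|B|²/2`. Hence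
  -- the value at `2E` is at least `E`.
  have hglow : ∀ η, ξ ≤ η → η / 2 ≤ g η := fun η hη => by
    have hη0 := hξ.trans_le hη
    have h1 := hPle η hη
    have hN0 := hNpos η hη
    have hh0 : 0 < h η := by simp only [hh]; positivity
    have h2 : D * N η * h η = η * (1 - f η) := by
      rw [← hNsq η hη]; simp only [hh]; field_simp
    have h3 : 0 ≤ D * N η * (1 / h η) := by positivity
    have h4 : (m ⬝ᵥ B / η) ^ 2 ≤ f η * (B ⬝ᵥ B) := by
      rw [← velOf_dot_mag hη0]; exact dot_sq_le _ _
    have h5 : 0 ≤ η * f η := mul_nonneg hη0.le (dot_self_nonneg' _)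
    simp only [hg]
    linarith
  have hX : ξ ≤ max ξ (2 * E) := le_max_left _ _
  have hgX : E ≤ g (max ξ (2 * E)) := by
    have := hglow _ hX
    have := le_max_right ξ (2 * E)
    linarith
  obtain ⟨η, hη, hgη⟩ := intermediate_value_Icc hX (hgc.mono fun η hη => hη.1) ⟨hgξ, hgX⟩
  -- The strict energy excess excludes the endpoint, where the pressure would vanish.
  have hηlt : ξ < η := by
    refine lt_of_le_of_ne hη.1 ?_
    rintro rfl
    have : g ξ < E := by
      refine lt_of_eq_of_lt ?_ hE
      have : 1 - f ξ = D ^ 2 / ξ ^ 2 := by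
        rw [coldFun] at hcold
        simp only [hf]; linarith
      simp only [hg, hPξ, this, magCoeff]
      field_simp
      ring
    exact this.ne hgη
  have hη0 := hξ.trans hηlt
  have hN0 := hNpos η hη.1
  obtain ⟨hp, hpe⟩ := hP η hηlt
  have hlor : Prim.lorentz ⟨D * N η, P η, velOf m B η, B⟩ = (N η)⁻¹ := by
    simp only [Prim.lorentz, hN, hf, one_div]
  have hent : Prim.enthalpy H ⟨D * N η, P η, velOf m B η, B⟩ = h η := hpe
  have hξW : D * N η * h η * ((N η)⁻¹) ^ 2 = η := by
    simp only [hh]; field_simp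
  refine ⟨⟨D * N η, P η, velOf m B η, B⟩, ⟨by positivity, hp, ?_, ?_⟩, ?_⟩
  · have := hH.one_add_lt hp (mul_pos hD hN0)
    rw [Prim.internalEnergy, hent]
    simp only [← hpe]; linarith
  · rw [Real.sqrt_lt' one_pos]
    have := hpos η hη.1
    simp only [hf] at this
    linarith
  · have hmom : Prim.mom H ⟨D * N η, P η, velOf m B η, B⟩ = m := by
      have hne : η + B ⬝ᵥ B ≠ 0 := by positivity
      simp only [Prim.mom, hent, hlor, hξW, velOf_dot_mag hη0]
      rw [velOf, smul_smul, mul_inv_cancel₀ hne, one_smul, add_sub_cancel_right]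
    have hrho : D * N η * (N η)⁻¹ = D := by field_simp
    have hen : η - (P η + (N η ^ 2 * (B ⬝ᵥ B) + (m ⬝ᵥ B / η) ^ 2) / 2) + B ⬝ᵥ B = E := by
      rw [← hgη, hNsq η hη.1]
    simp only [Prim.toCons, hmom, Prim.pTot, hent, hlor, hξW, velOf_dot_mag hη0, inv_inv, hen,
      hrho]

/-- At the pressureless state the linear constraint measures the energy excess. -/
theorem nStar_velOf {E : ℝ} (hD : 0 < D) (hξ : 0 < ξ) (hcold : coldFun D m B ξ = 0) :
    nStar (velOf m B ξ) B ⬝ᵥ pack D m B E + pStar (velOf m B ξ) B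
      = E - (ξ + B ⬝ᵥ B - magCoeff D m B / (2 * ξ ^ 2)) := by
  have hb := dot_self_nonneg' B
  have hvm : velOf m B ξ ⬝ᵥ m
      = (ξ + B ⬝ᵥ B) * (velOf m B ξ ⬝ᵥ velOf m B ξ) - (m ⬝ᵥ B / ξ) ^ 2 := by
    have hne : ξ + B ⬝ᵥ B ≠ 0 := by positivity
    have : m = (ξ + B ⬝ᵥ B) • velOf m B ξ - (m ⬝ᵥ B / ξ) • B := by
      conv_rhs => rw [velOf, smul_smul, mul_inv_cancel₀ hne, one_smul, add_sub_cancel_right]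
    conv_lhs => rw [this]
    rw [dotProduct_sub, dotProduct_smul, dotProduct_smul, ← this, velOf_dot_mag hξ]
    simp only [smul_eq_mul]
    ring
  have hvB := velOf_dot_mag (m := m) (B := B) hξ
  have h1 : 1 - velOf m B ξ ⬝ᵥ velOf m B ξ = D ^ 2 / ξ ^ 2 := by
    rw [coldFun] at hcold; linarith
  have h2 : velOf m B ξ ⬝ᵥ velOf m B ξ = 1 - D ^ 2 / ξ ^ 2 := by linarith
  have hs : √(1 - velOf m B ξ ⬝ᵥ velOf m B ξ) = D / ξ := by
    rw [h1, ← div_pow]; exact Real.sqrt_sq (by positivity)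
  have hsplit : ∀ v : Fin 3 → ℝ, nStar v B ⬝ᵥ pack D m B E + pStar v B
      = E - D * √(1 - v ⬝ᵥ v) - v ⬝ᵥ m - ((1 - v ⬝ᵥ v) * (B ⬝ᵥ B) + (v ⬝ᵥ B) ^ 2) / 2 := by
    intro v
    simp only [nStar, pack, pStar]
    generalize √(1 - v ⬝ᵥ v) = s
    simp only [dotProduct, Fin.sum_univ_three, Pi.add_apply, Pi.neg_apply, Pi.smul_apply,
      smul_eq_mul, Matrix.cons_val, Fin.sum_univ_eight]
    ring
  rw [hsplit, hs, h1, hvm, h2, hvB, magCoeff]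
  field_simp
  ring

end

/-! ### Linear constraints and the function Ψ -/

theorem pack_momOf_magOf (U : State) : pack (U 0) (momOf U) (magOf U) (U 7) = U := by
  funext i; fin_cases i <;> rfl

/-- Characterization of the admissible set by linear constraints. -/
theorem mem_adm_iff {H : ℝ → ℝ → ℝ} (hH : IsCausalEOS H) (U : State) :
    U ∈ Adm H ↔ 0 < U 0 ∧
      ∀ v B : Fin 3 → ℝ, v ⬝ᵥ v < 1 → 0 < nStar v B ⬝ᵥ U + pStar v B := by
  constructor
  · rintro ⟨w, hw, rfl⟩
    refine ⟨?_, fun v B hv => Prim.nStar_pos hH hw B hv⟩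
    exact mul_pos hw.1 hw.lorentz_pos
  · rintro ⟨hD, h⟩
    obtain ⟨ξ, hξ, hcold⟩ := exists_coldFun_eq_zero hD (momOf U) (magOf U)
    have hv : velOf (momOf U) (magOf U) ξ ⬝ᵥ velOf (momOf U) (magOf U) ξ < 1 := by
      have h1 := hcold
      rw [coldFun] at h1
      have : 0 < U 0 ^ 2 / ξ ^ 2 := by positivity
      linarith
    have h1 := h _ (magOf U) hv
    have h2 := nStar_velOf (E := U 7) hD hξ hcold
    rw [pack_momOf_magOf] at h2
    rw [← pack_momOf_magOf U]
    exact pack_mem_adm hH hD hξ hcold (by linarith)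

/-- Nonnegativity of `Ψ` bounds the energy from below by that of the pressureless state. -/
theorem cold_energy_le {D E ξ : ℝ} {m B : Fin 3 → ℝ} (hD : 0 < D) (hξ : 0 < ξ)
    (hcold : coldFun D m B ξ = 0) (hq : √(D ^ 2 + m ⬝ᵥ m) ≤ E)
    (hψ : √(27 / 2 * magCoeff D m B) ≤
      (√((B ⬝ᵥ B - E) ^ 2 + 3 * (E ^ 2 - D ^ 2 - m ⬝ᵥ m)) - 2 * (B ⬝ᵥ B - E))
        * √(√((B ⬝ᵥ B - E) ^ 2 + 3 * (E ^ 2 - D ^ 2 - m ⬝ᵥ m)) + B ⬝ᵥ B - E)) :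
    ξ + B ⬝ᵥ B - magCoeff D m B / (2 * ξ ^ 2) ≤ E := by
  have hm := dot_self_nonneg' m
  have hb := dot_self_nonneg' B
  have hM : 0 < D ^ 2 + m ⬝ᵥ m := by positivity
  have hL := magCoeff_nonneg D m B
  have hLb : 0 < B ⬝ᵥ B → 0 < magCoeff D m B := fun h => by unfold magCoeff; positivity
  have hE0 : 0 < E := (Real.sqrt_pos.2 hM).trans_le hq
  have hEM : D ^ 2 + m ⬝ᵥ m ≤ E ^ 2 := (Real.sqrt_le_left hE0.le).1 hq
  have hmul := coldFun_mul (D := D) (m := m) (B := B) hξ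
  rw [hcold, mul_zero] at hmul
  have hmulx := fun x hx => coldFun_mul (D := D) (m := m) (B := B) (ξ := x) hx
  have hmono := coldFun_strictMonoOn (D := D) (m := m) (B := B) hD
  generalize magCoeff D m B = L at *
  generalize hbeq : B ⬝ᵥ B = b at *
  generalize hM2 : m ⬝ᵥ m = m2 at *
  set β := b - E with hβ
  have hrad : 0 ≤ β ^ 2 + 3 * (E ^ 2 - D ^ 2 - m2) := by nlinarith [sq_nonneg β]
  have hΦ2 := Real.sq_sqrt hrad
  have hΦβ : |β| ≤ √(β ^ 2 + 3 * (E ^ 2 - D ^ 2 - m2)) :=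
    Real.abs_le_sqrt (by linarith)
  set Φ := √(β ^ 2 + 3 * (E ^ 2 - D ^ 2 - m2))
  have hΦβ' : 0 ≤ Φ + β := by linarith [neg_abs_le β]
  rw [show Φ + b - E = Φ + β by rw [hβ]; ring] at hψ
  have hroot := Real.sqrt_nonneg (Φ + β)
  have hx0 : 0 < Φ - 2 * β := by
    rcases hb.eq_or_lt with h0 | h0
    · have : β < 0 := by rw [hβ]; linarith
      linarith [abs_nonneg β]
    · have h1 : 0 < √(27 / 2 * L) := Real.sqrt_pos.2 (by linarith [hLb h0])
      exact pos_of_mul_pos_left (h1.trans_le hψ) hroot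
  have hcub : 27 / 2 * L ≤ (Φ - 2 * β) ^ 2 * (Φ + β) := by
    have h1 := pow_le_pow_left₀ (Real.sqrt_nonneg _) hψ 2
    rwa [Real.sq_sqrt (by positivity), mul_pow, Real.sq_sqrt hΦβ'] at h1
  -- `x` is the larger root of the quadratic obtained by eliminating `L` from `coldFun = 0` and the
  -- equality case `L = 2x²(x + β)` of the energy bound. The hypothesis on Ψ says `L ≤ 2x²(x + β)`
  -- at this root.
  set x := (Φ - 2 * β) / 3 with hx
  have hxpos : 0 < x := by positivity
  have hΦx : Φ = 3 * x + 2 * β := by rw [hx]; ring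
  have hxquad : 3 * x ^ 2 + 4 * β * x + β ^ 2 - (E ^ 2 - D ^ 2 - m2) = 0 := by
    rw [hΦx] at hΦ2
    linarith
  have hxL : L ≤ 2 * x ^ 2 * (x + β) := by
    rw [hΦx] at hcub
    linarith
  have hξx : ξ ≤ x := by
    by_contra hlt
    have h1 := hmono hxpos hξ (not_le.1 hlt)
    rw [hcold] at h1
    have h2 : x ^ 2 * (x + b) ^ 2 * coldFun D m B x < 0 :=
      mul_neg_of_pos_of_neg (by positivity) h1
    rw [hmulx x hxpos] at h2
    have h3 := mul_le_mul_of_nonneg_left hxL (by positivity : 0 ≤ 2 * x + b)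
    have h4 : x ^ 2 * ((x + b) ^ 2 - (D ^ 2 + m2)) - (2 * x + b) * (2 * x ^ 2 * (x + β))
        = -(x ^ 2 * (3 * x ^ 2 + 4 * β * x + β ^ 2 - (E ^ 2 - D ^ 2 - m2))) := by
      rw [hβ]; ring
    rw [hxquad] at h4
    linarith
  -- If the bound failed, the same elimination at ξ would make the quadratic positive there,
  -- although ξ lies between its vertex and its larger root `x`.
  by_contra hlt
  have h1 : L / (2 * ξ ^ 2) < ξ + β := by rw [hβ]; linarith
  have h1' : 0 < ξ + β := (by positivity : 0 ≤ L / (2 * ξ ^ 2)).trans_lt h1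
  rw [div_lt_iff₀ (by positivity)] at h1
  have h2 := mul_lt_mul_of_pos_left h1 (by positivity : 0 < 2 * ξ + b)
  have h3 : ξ ^ 2 * ((ξ + b) ^ 2 - (D ^ 2 + m2)) - (2 * ξ + b) * ((ξ + β) * (2 * ξ ^ 2))
      = -(ξ ^ 2 * (3 * ξ ^ 2 + 4 * β * ξ + β ^ 2 - (E ^ 2 - D ^ 2 - m2))) := by
    rw [hβ]; ring
  have h4 : 0 < ξ ^ 2 * (3 * ξ ^ 2 + 4 * β * ξ + β ^ 2 - (E ^ 2 - D ^ 2 - m2)) := by linarith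
  have h5 := pos_of_mul_pos_right h4 (by positivity)
  have h6 : 0 < (ξ - x) * (3 * (ξ + x) + 4 * β) := by linarith
  have h7 : 0 ≤ 3 * (ξ + x) + 4 * β := by
    have : 3 * x = Φ - 2 * β := by rw [hΦx]; ring
    rcases abs_cases β with h | h <;> linarith
  nlinarith

theorem momOf_update (U : State) (E : ℝ) : momOf (Function.update U 7 E) = momOf U := by
  funext i; fin_cases i <;> rfl

theorem magOf_update (U : State) (E : ℝ) : magOf (Function.update U 7 E) = magOf U := by
  funext i; fin_cases i <;> rfl

/-- Ψ_ε is Ψ at energy `E - ε`, so the nonstrict bound of `cold_energy_le` leaves a strict excess at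
`E`. -/
theorem admEps_subset_adm {H : ℝ → ℝ → ℝ} (hH : IsCausalEOS H) {ε : ℝ} (hε : 0 < ε) :
    AdmEps ε ⊆ Adm H := by
  rintro U ⟨hD, hq, hψ⟩
  have hD0 : 0 < U 0 := hε.trans_le hD
  obtain ⟨ξ, hξ, hcold⟩ := exists_coldFun_eq_zero hD0 (momOf U) (magOf U)
  have h0 : Function.update U 7 (U 7 - ε) 0 = U 0 := rfl
  have h7 : Function.update U 7 (U 7 - ε) 7 = U 7 - ε := by simp
  simp only [psiEps, psiFun, phiFun, momOf_update, magOf_update, h0, h7] at hψ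
  rw [qFun] at hq
  have := cold_energy_le (E := U 7 - ε) hD0 hξ hcold (by linarith) (sub_nonneg.1 hψ)
  rw [← pack_momOf_magOf U]
  exact pack_mem_adm hH hD0 hξ hcold (by linarith)

theorem continuous_psiEps (ε : ℝ) : Continuous (psiEps ε) := by
  unfold psiEps psiFun phiFun
  simp only [momOf_update, magOf_update, Function.update_self]
  have h0 : ∀ U : State, Function.update U 7 (U 7 - ε) 0 = U 0 := fun U => rfl
  simp only [h0, momOf, magOf, dotProduct, Fin.sum_univ_three, Matrix.cons_val]
  fun_prop

/-! ### Stream functions of divergence-free polynomial fields -/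

/-- Antiderivative of a polynomial with respect to the variable `i`. -/
def antideriv (i : Fin 2) : MvPolynomial (Fin 2) ℝ →ₗ[ℝ] MvPolynomial (Fin 2) ℝ :=
  (MvPolynomial.basisMonomials (Fin 2) ℝ).constr ℝ fun s =>
    MvPolynomial.monomial (s + Finsupp.single i 1) (1 / ((s i : ℝ) + 1))

theorem antideriv_monomial (i : Fin 2) (s : Fin 2 →₀ ℕ) (c : ℝ) :
    antideriv i (MvPolynomial.monomial s c)
      = MvPolynomial.monomial (s + Finsupp.single i 1) (c / ((s i : ℝ) + 1)) := by
  have h := (MvPolynomial.basisMonomials (Fin 2) ℝ).constr_basis ℝ (fun s : Fin 2 →₀ ℕ =>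
    MvPolynomial.monomial (s + Finsupp.single i 1) (1 / ((s i : ℝ) + 1))) s
  have h2 : MvPolynomial.monomial s c = c • (MvPolynomial.monomial s (1 : ℝ)) := by
    rw [MvPolynomial.smul_monomial, smul_eq_mul, mul_one]
  rw [h2, map_smul, antideriv]
  rw [MvPolynomial.coe_basisMonomials] at h
  rw [h, MvPolynomial.smul_monomial, smul_eq_mul, mul_one_div]

theorem pderiv_antideriv_self (i : Fin 2) (p : MvPolynomial (Fin 2) ℝ) :
    MvPolynomial.pderiv i (antideriv i p) = p := by
  induction p using MvPolynomial.induction_on' with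
  | monomial s c =>
    rw [antideriv_monomial, MvPolynomial.pderiv_monomial]
    have : (s i : ℝ) + 1 ≠ 0 := by positivity
    simp [this]
  | add p q hp hq => rw [map_add, map_add, hp, hq]

theorem pderiv_antideriv_of_ne {i j : Fin 2} (hij : i ≠ j) (p : MvPolynomial (Fin 2) ℝ) :
    MvPolynomial.pderiv j (antideriv i p) = antideriv i (MvPolynomial.pderiv j p) := by
  induction p using MvPolynomial.induction_on' with
  | monomial s c =>
    rw [antideriv_monomial, MvPolynomial.pderiv_monomial, MvPolynomial.pderiv_monomial,
      antideriv_monomial]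
    have h1 : (s + Finsupp.single i 1 : Fin 2 →₀ ℕ) j = s j := by simp [hij]
    have h2 : (s - Finsupp.single j 1 : Fin 2 →₀ ℕ) i = s i := by simp [hij.symm]
    rw [h1, h2]
    rcases Nat.eq_zero_or_pos (s j) with h0 | h0
    · simp [h0]
    · have h3 : s + Finsupp.single i 1 - Finsupp.single j 1
          = s - Finsupp.single j 1 + Finsupp.single i 1 :=
        tsub_add_eq_add_tsub (Finsupp.single_le_iff.2 h0) |>.symm
      rw [h3]
      congr 1
      ring
  | add p q hp hq => rw [map_add, map_add, map_add, map_add, hp, hq]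

/-- Integrate `p` in the second variable. The defect `g` in the other equation does not depend on
that variable, so its antiderivative in the first variable repairs one equation without disturbing
the other. -/
theorem exists_stream {p q : MvPolynomial (Fin 2) ℝ}
    (h : MvPolynomial.pderiv 0 p + MvPolynomial.pderiv 1 q = 0) :
    ∃ ψ : MvPolynomial (Fin 2) ℝ, MvPolynomial.pderiv 1 ψ = p ∧ MvPolynomial.pderiv 0 ψ = -q := by
  set g := MvPolynomial.pderiv 0 (antideriv 1 p) + q with hg
  have hg1 : MvPolynomial.pderiv 1 g = 0 := by
    rw [hg, map_add, pderiv_antideriv_of_ne (by decide), pderiv_antideriv_self, h]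
  refine ⟨antideriv 1 p - antideriv 0 g, ?_, ?_⟩
  · rw [map_sub, pderiv_antideriv_self, pderiv_antideriv_of_ne (by decide), hg1, map_zero, sub_zero]
  · rw [map_sub, pderiv_antideriv_self, hg]
    ring

/-- The restriction of a polynomial to the line `a + s d`. -/
def onLine (a d : Pt) : MvPolynomial (Fin 2) ℝ →ₐ[ℝ] Polynomial ℝ :=
  MvPolynomial.aeval fun i => Polynomial.C (a i) + Polynomial.C (d i) * Polynomial.X

theorem eval_onLine (a d : Pt) (s : ℝ) (p : MvPolynomial (Fin 2) ℝ) :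
    (onLine a d p).eval s = MvPolynomial.eval (a + s • d) p := by
  induction p using MvPolynomial.induction_on with
  | C c => simp [onLine]
  | add p q hp hq => simp [hp, hq]
  | mul_X p i hp =>
    rw [map_mul, Polynomial.eval_mul, hp]
    simp [onLine, mul_comm s]

theorem derivative_onLine (a d : Pt) (p : MvPolynomial (Fin 2) ℝ) :
    Polynomial.derivative (onLine a d p)
      = onLine a d (MvPolynomial.C (d 0) * MvPolynomial.pderiv 0 p
          + MvPolynomial.C (d 1) * MvPolynomial.pderiv 1 p) := by
  induction p using MvPolynomial.induction_on with
  | C c => simp [onLine]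
  | add p q hp hq =>
    rw [map_add, Polynomial.derivative_add, hp, hq, ← map_add]
    congr 1
    simp only [map_add]
    ring
  | mul_X p i hp =>
    have hX : onLine a d (MvPolynomial.X i)
        = Polynomial.C (a i) + Polynomial.C (d i) * Polynomial.X := by simp [onLine]
    have hC : ∀ c, onLine a d (MvPolynomial.C c) = Polynomial.C c := fun c => by simp [onLine]
    rw [map_mul, Polynomial.derivative_mul, hp]
    simp only [Derivation.leibniz, smul_eq_mul, map_add, map_mul, hX, hC]
    fin_cases i <;> simp [MvPolynomial.pderiv_X] <;> ring

theorem natDegree_onLine_le (a d : Pt) {p : MvPolynomial (Fin 2) ℝ} {n : ℕ}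
    (hp : p.totalDegree ≤ n) : (onLine a d p).natDegree ≤ n := by
  have := MvPolynomial.aeval_natDegree_le p hp
    (fun i => Polynomial.C (a i) + Polynomial.C (d i) * Polynomial.X) (n := 1) fun i => by
      compute_degree
  rw [mul_one] at this
  exact this

namespace EdgeRule

variable {k : ℕ} (R : EdgeRule k)

theorem sum_eval (g : Polynomial ℝ) (hg : g.natDegree ≤ 2 * k) :
    ∑ q, R.weight q * g.eval (R.node q) = ∫ s in (0 : ℝ)..1, g.eval s := by
  simp only [Polynomial.eval_eq_sum_range, Finset.mul_sum]
  rw [Finset.sum_comm, intervalIntegral.integral_finsetSum]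
  · refine Finset.sum_congr rfl fun i hi => ?_
    rw [intervalIntegral.integral_const_mul, ← R.exact i, Finset.mul_sum]
    · exact Finset.sum_congr rfl fun q _ => by ring
    · have := Finset.mem_range.1 hi
      omega
  · intro i _
    exact (by fun_prop : Continuous fun s : ℝ => g.coeff i * s ^ i).intervalIntegrable _ _

theorem sum_weight : ∑ q, R.weight q = 1 := by
  have := R.exact 0 (Nat.zero_le _)
  simpa using this

theorem nonempty : Nonempty (Fin R.Q) := by
  by_contra h
  rw [not_nonempty_iff] at h
  have := R.sum_weight
  simp at this

/-- The flux of a divergence-free field through a segment is a difference of values of its stream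
function. -/
theorem sum_flux_eq {p q ψ : MvPolynomial (Fin 2) ℝ} (hp : p.totalDegree ≤ k)
    (hq : q.totalDegree ≤ k) (h1 : MvPolynomial.pderiv 1 ψ = p)
    (h0 : MvPolynomial.pderiv 0 ψ = -q) (a d : Pt) :
    ∑ i, R.weight i * (d 1 * MvPolynomial.eval (a + R.node i • d) p
        - d 0 * MvPolynomial.eval (a + R.node i • d) q)
      = MvPolynomial.eval (a + d) ψ - MvPolynomial.eval a ψ := by
  have hD : Polynomial.derivative (onLine a d ψ) = Polynomial.C (d 1) * onLine a d p
      - Polynomial.C (d 0) * onLine a d q := by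
    rw [derivative_onLine, h0, h1]
    simp only [map_add, map_mul, map_neg]
    simp only [onLine, MvPolynomial.algHom_C, Polynomial.algebraMap_eq]
    ring
  -- Only the derivative along the edge is integrated. It is a combination of `p` and `q` there, so
  -- no degree bound on ψ itself is needed.
  have hdeg : (Polynomial.derivative (onLine a d ψ)).natDegree ≤ 2 * k := by
    rw [hD]
    refine (Polynomial.natDegree_sub_le_of_le (Polynomial.natDegree_C_mul_le _ _)
      (Polynomial.natDegree_C_mul_le _ _)).trans (max_le ?_ ?_)
    · exact (natDegree_onLine_le a d hp).trans (by omega)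
    · exact (natDegree_onLine_le a d hq).trans (by omega)
  have h2 := R.sum_eval _ hdeg
  rw [intervalIntegral.integral_eq_sub_of_hasDerivAt
    (fun s _ => Polynomial.hasDerivAt (onLine a d ψ) s)
    ((Polynomial.continuous _).intervalIntegrable _ _), eval_onLine, eval_onLine] at h2
  simp only [one_smul, zero_smul, add_zero] at h2
  rw [← h2]
  refine Finset.sum_congr rfl fun i _ => ?_
  rw [hD]
  simp [eval_onLine]

end EdgeRule

/-! ### Polygons -/

namespace PolygonalCell

variable (P : PolygonalCell)

theorem len_pos (j : Fin P.nv) : 0 < P.len j := by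
  have hne : P.src j ≠ P.tgt j := fun h => by
    have h1 := P.vertex_injective h
    have h2 := support_finRotate_of_le (n := P.nv) (by have := P.three_le; omega)
    have h3 : j ∈ (finRotate P.nv).support := by rw [h2]; exact Finset.mem_univ j
    exact (Equiv.Perm.mem_support.1 h3) h1.symm
  refine Real.sqrt_pos.2 ?_
  by_contra h
  apply hne
  have h0 := sq_nonneg (P.tgt j 0 - P.src j 0)
  have h1 := sq_nonneg (P.tgt j 1 - P.src j 1)
  have e0 : (P.tgt j 0 - P.src j 0) ^ 2 = 0 := by linarith
  have e1 : (P.tgt j 1 - P.src j 1) ^ 2 = 0 := by linarith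
  rw [sq_eq_zero_iff, sub_eq_zero] at e0 e1
  funext i
  fin_cases i
  · exact e0.symm
  · exact e1.symm

theorem len_mul_normal_zero (j : Fin P.nv) :
    P.len j * P.normal j 0 = P.tgt j 1 - P.src j 1 :=
  mul_div_cancel₀ _ (P.len_pos j).ne'

theorem len_mul_normal_one (j : Fin P.nv) :
    P.len j * P.normal j 1 = -(P.tgt j 0 - P.src j 0) :=
  mul_div_cancel₀ _ (P.len_pos j).ne'

theorem normal_sq (j : Fin P.nv) : P.normal j 0 ^ 2 + P.normal j 1 ^ 2 = 1 := by
  have h := P.len_pos j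
  have h2 : P.len j ^ 2 = (P.tgt j 0 - P.src j 0) ^ 2 + (P.tgt j 1 - P.src j 1) ^ 2 :=
    Real.sq_sqrt (by positivity)
  have h3 : P.len j ^ 2 * (P.normal j 0 ^ 2 + P.normal j 1 ^ 2) = P.len j ^ 2 * 1 := by
    rw [mul_add, ← mul_pow, ← mul_pow, len_mul_normal_zero, len_mul_normal_one, h2]
    ring
  exact mul_left_cancel₀ (pow_ne_zero 2 h.ne') h3

theorem sum_tgt_sub_src (f : Pt → ℝ) : ∑ j, (f (P.tgt j) - f (P.src j)) = 0 := by
  rw [Finset.sum_sub_distrib, sub_eq_zero]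
  exact Equiv.sum_comp (finRotate P.nv) fun j => f (P.vertex j)

theorem sum_len_mul_normal (i : Fin 2) : ∑ j, P.len j * P.normal j i = 0 := by
  fin_cases i
  · simp only [Fin.zero_eta, len_mul_normal_zero]
    exact P.sum_tgt_sub_src fun x => x 1
  · simp only [Fin.mk_one, len_mul_normal_one, Finset.sum_neg_distrib, neg_eq_zero]
    exact P.sum_tgt_sub_src fun x => x 0

/-- The discrete flux of a divergence-free polynomial field through the boundary vanishes. -/
theorem sum_flux_eq_zero {k : ℕ} (R : EdgeRule k) {p q : MvPolynomial (Fin 2) ℝ}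
    (hp : p.totalDegree ≤ k) (hq : q.totalDegree ≤ k)
    (h : MvPolynomial.pderiv 0 p + MvPolynomial.pderiv 1 q = 0) :
    ∑ j, P.len j * ∑ i, R.weight i *
      (P.normal j 0 * MvPolynomial.eval (P.edgePt j (R.node i)) p
        + P.normal j 1 * MvPolynomial.eval (P.edgePt j (R.node i)) q) = 0 := by
  obtain ⟨ψ, h1, h0⟩ := exists_stream h
  rw [← P.sum_tgt_sub_src fun x => MvPolynomial.eval x ψ]
  refine Finset.sum_congr rfl fun j _ => ?_
  have := R.sum_flux_eq hp hq h1 h0 (P.src j) (P.tgt j - P.src j)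
  rw [add_sub_cancel] at this
  rw [← this, Finset.mul_sum]
  refine Finset.sum_congr rfl fun i _ => ?_
  rw [mul_left_comm, mul_add, ← mul_assoc, ← mul_assoc, len_mul_normal_zero, len_mul_normal_one]
  simp only [edgePt, Pi.sub_apply]
  ring

theorem area_pos : 0 < P.area := by
  have hne : (interior P.carrier).Nonempty := by
    by_contra hne
    rw [not_nonempty_iff_eq_empty] at hne
    have h3 := P.regular
    have h4 := P.frontier_eq
    rw [hne, closure_empty] at h3
    rw [← h3, frontier_empty] at h4
    have h5 : P.vertex ⟨0, by have := P.three_le; omega⟩ ∈ (∅ : Set Pt) := by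
      rw [h4]
      exact mem_iUnion.2 ⟨_, left_mem_segment ℝ _ _⟩
    exact h5
  have h1 : 0 < volume P.carrier :=
    (isOpen_interior.measure_pos volume hne).trans_le (measure_mono interior_subset)
  exact ENNReal.toReal_pos h1.ne' P.isCompact.measure_lt_top.ne

/-- The average of a polynomial over the cell. -/
def avg (p : MvPolynomial (Fin 2) ℝ) : ℝ :=
  1 / P.area * ∫ x in P.carrier, MvPolynomial.eval x p

theorem integrableOn_eval (p : MvPolynomial (Fin 2) ℝ) :
    IntegrableOn (fun x => MvPolynomial.eval x p) P.carrier :=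
  (MvPolynomial.continuous_eval p).continuousOn.integrableOn_compact P.isCompact

theorem avg_add (p q : MvPolynomial (Fin 2) ℝ) : P.avg (p + q) = P.avg p + P.avg q := by
  simp only [avg, map_add]
  rw [integral_add (P.integrableOn_eval p) (P.integrableOn_eval q), mul_add]

theorem avg_C_mul (c : ℝ) (p : MvPolynomial (Fin 2) ℝ) :
    P.avg (MvPolynomial.C c * p) = c * P.avg p := by
  simp only [avg, map_mul, MvPolynomial.eval_C]
  rw [integral_const_mul, mul_left_comm]

theorem avg_C (c : ℝ) : P.avg (MvPolynomial.C c) = c := by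
  have := P.area_pos
  simp only [avg, MvPolynomial.eval_C, setIntegral_const, smul_eq_mul]
  rw [area] at *
  field_simp

theorem avg_scaleTo (θ : ℝ) (p : MvPolynomial (Fin 2) ℝ) {c : ℝ} (hc : P.avg p = c) :
    P.avg (Discretization.scaleTo θ c p) = c := by
  have h : p - MvPolynomial.C c = p + MvPolynomial.C (-c) := by rw [map_neg, sub_eq_add_neg]
  rw [Discretization.scaleTo, avg_add, avg_C_mul, h, avg_add, avg_C, avg_C, hc]
  ring

end PolygonalCell

/-! ### Convexity of the admissible set and concavity of `q` -/

theorem convex_adm {H : ℝ → ℝ → ℝ} (hH : IsCausalEOS H) : Convex ℝ (Adm H) := by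
  intro U hU V hV a b ha hb hab
  rw [mem_adm_iff hH] at *
  have hpos : ∀ x y : ℝ, 0 < x → 0 < y → 0 < a * x + b * y := fun x y hx hy => by
    rcases ha.eq_or_lt with rfl | ha'
    · rw [zero_add] at hab
      subst hab
      simpa using hy
    · exact add_pos_of_pos_of_nonneg (mul_pos ha' hx) (mul_nonneg hb hy.le)
  refine ⟨by simpa using hpos _ _ hU.1 hV.1, fun v B hv => ?_⟩
  have h := hpos _ _ (hU.2 v B hv) (hV.2 v B hv)
  rw [dotProduct_add, dotProduct_smul, dotProduct_smul, smul_eq_mul, smul_eq_mul]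
  have e : pStar v B = a * pStar v B + b * pStar v B := by rw [← add_mul, hab, one_mul]
  linarith

theorem concaveOn_qFun : ConcaveOn ℝ univ qFun := by
  refine ⟨convex_univ, fun U _ V _ a b ha hb _ => ?_⟩
  have hS : ∀ U : State, U 0 ^ 2 + momOf U ⬝ᵥ momOf U = U 0 ^ 2 + U 1 ^ 2 + U 2 ^ 2 + U 3 ^ 2 :=
    fun U => by
      simp only [momOf, dotProduct, Fin.sum_univ_three, Matrix.cons_val]
      ring
  simp only [qFun, hS]
  simp only [Pi.add_apply, Pi.smul_apply, smul_eq_mul]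
  have hu : 0 ≤ U 0 ^ 2 + U 1 ^ 2 + U 2 ^ 2 + U 3 ^ 2 := by positivity
  have hv : 0 ≤ V 0 ^ 2 + V 1 ^ 2 + V 2 ^ 2 + V 3 ^ 2 := by positivity
  have hu2 := Real.sq_sqrt hu
  have hv2 := Real.sq_sqrt hv
  have hu0 := Real.sqrt_nonneg (U 0 ^ 2 + U 1 ^ 2 + U 2 ^ 2 + U 3 ^ 2)
  have hv0 := Real.sqrt_nonneg (V 0 ^ 2 + V 1 ^ 2 + V 2 ^ 2 + V 3 ^ 2)
  have hcs : U 0 * V 0 + U 1 * V 1 + U 2 * V 2 + U 3 * V 3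
      ≤ √(U 0 ^ 2 + U 1 ^ 2 + U 2 ^ 2 + U 3 ^ 2) * √(V 0 ^ 2 + V 1 ^ 2 + V 2 ^ 2 + V 3 ^ 2) := by
    rw [← Real.sqrt_mul hu]
    refine Real.le_sqrt_of_sq_le ?_
    have := Finset.sum_mul_sq_le_sq_mul_sq Finset.univ ![U 0, U 1, U 2, U 3]
      ![V 0, V 1, V 2, V 3]
    simpa [Fin.sum_univ_four] using this
  set r := √(U 0 ^ 2 + U 1 ^ 2 + U 2 ^ 2 + U 3 ^ 2)
  set t := √(V 0 ^ 2 + V 1 ^ 2 + V 2 ^ 2 + V 3 ^ 2)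
  have key : √((a * U 0 + b * V 0) ^ 2 + (a * U 1 + b * V 1) ^ 2 + (a * U 2 + b * V 2) ^ 2
      + (a * U 3 + b * V 3) ^ 2) ≤ a * r + b * t := by
    refine Real.sqrt_le_iff.2 ⟨by positivity, ?_⟩
    have h := mul_le_mul_of_nonneg_left hcs (mul_nonneg ha hb)
    have e : (a * r + b * t) ^ 2 = a ^ 2 * (U 0 ^ 2 + U 1 ^ 2 + U 2 ^ 2 + U 3 ^ 2)
        + b ^ 2 * (V 0 ^ 2 + V 1 ^ 2 + V 2 ^ 2 + V 3 ^ 2) + 2 * (a * b * (r * t)) := by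
      rw [← hu2, ← hv2]; ring
    rw [e]
    linarith
  linarith

/-- `q` does not see the magnetic field, which allows the second limiting step to leave `B`
unscaled. -/
theorem qFun_congr {U V : State} (h0 : U 0 = V 0) (h1 : U 1 = V 1) (h2 : U 2 = V 2)
    (h3 : U 3 = V 3) (h7 : U 7 = V 7) : qFun U = qFun V := by
  simp only [qFun, momOf, h0, h1, h2, h3, h7]

namespace Discretization

variable {ι : Type*} {k : ℕ} (T : Discretization ι k)

/-! ### The auxiliary quadrature -/

/-- Index set of the auxiliary quadrature rule of a cell. -/
abbrev AuxIdx (K : ι) : Type :=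
  (Fin (T.mesh.cell K).nv × Fin T.edgeRule.Q) ⊕ Fin (T.cellRule K).auxNum

/-- Points of the auxiliary quadrature rule. -/
def auxPt (K : ι) : T.AuxIdx K → Pt :=
  Sum.elim (fun jq => T.edgeNode K jq.1 jq.2) (T.cellRule K).auxNode

/-- Weights of the auxiliary quadrature rule. -/
def auxWt (K : ι) : T.AuxIdx K → ℝ :=
  Sum.elim (fun jq => (T.cellRule K).edgeWeight jq.1 jq.2) (T.cellRule K).auxWeight

theorem auxPt_mem (K : ι) (i : T.AuxIdx K) : T.auxPt K i ∈ T.critPts K := by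
  rcases i with i | i
  · exact Or.inl (Or.inl ⟨i, rfl⟩)
  · exact Or.inl (Or.inr ⟨i, rfl⟩)

theorem edgeNode_mem (K : ι) (j q) : T.edgeNode K j q ∈ T.critPts K :=
  T.auxPt_mem K (Sum.inl (j, q))

theorem auxWt_pos (K : ι) (i : T.AuxIdx K) : 0 < T.auxWt K i := by
  rcases i with i | i
  · exact (T.cellRule K).edgeWeight_pos _ _
  · exact (T.cellRule K).auxWeight_pos _

theorem avg_eq_sum (K : ι) {p : MvPolynomial (Fin 2) ℝ} (hp : p.totalDegree ≤ k) :
    (T.mesh.cell K).avg p = ∑ i, T.auxWt K i * MvPolynomial.eval (T.auxPt K i) p := by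
  rw [PolygonalCell.avg, (T.cellRule K).aux_exact p hp, Fintype.sum_sum_type,
    Fintype.sum_prod_type]
  rfl

theorem sum_auxWt (K : ι) : ∑ i, T.auxWt K i = 1 := by
  have h := T.avg_eq_sum K (p := MvPolynomial.C 1) (by simp)
  rw [PolygonalCell.avg_C] at h
  simpa using h.symm

theorem cellAvg_apply (u : PW ι) (K : ι) (l : Fin 8) :
    T.cellAvg u K l = (T.mesh.cell K).avg (u K l) := rfl

theorem cellAvg_eq_sum {u : PW ι} {K : ι} (hu : ∀ l, (u K l).totalDegree ≤ k) :
    T.cellAvg u K = ∑ i, T.auxWt K i • evalAt u K (T.auxPt K i) := by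
  funext l
  rw [cellAvg_apply, T.avg_eq_sum K (hu l), Finset.sum_apply]
  rfl

/-! ### Minima over the critical points -/

theorem critPts_finite (K : ι) : (T.critPts K).Finite :=
  ((finite_range _).union (finite_range _)).union (finite_range _)

theorem critPts_nonempty (K : ι) : (T.critPts K).Nonempty := by
  obtain ⟨q⟩ := T.edgeRule.nonempty
  exact ⟨_, T.edgeNode_mem K ⟨0, by have := (T.mesh.cell K).three_le; omega⟩ q⟩

theorem critMin_le (K : ι) (f : Pt → ℝ) {x : Pt} (hx : x ∈ T.critPts K) :
    T.critMin K f ≤ f x :=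
  csInf_le ((T.critPts_finite K).image f).bddBelow (mem_image_of_mem f hx)

theorem le_critMin (K : ι) (f : Pt → ℝ) {c : ℝ} (h : ∀ x ∈ T.critPts K, c ≤ f x) :
    c ≤ T.critMin K f :=
  le_csInf ((T.critPts_nonempty K).image f) (by rintro _ ⟨x, hx, rfl⟩; exact h x hx)

/-- The average is a convex combination of values at auxiliary points, all of which are critical
points, so Jensen applies. -/
theorem critMin_le_of_concaveOn {f : State → ℝ} (hf : ConcaveOn ℝ univ f) {u : PW ι} {K : ι}
    (hu : ∀ l, (u K l).totalDegree ≤ k) :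
    T.critMin K (fun x => f (evalAt u K x)) ≤ f (T.cellAvg u K) := by
  rw [T.cellAvg_eq_sum hu]
  refine le_trans ?_ (hf.le_map_sum (fun i _ => (T.auxWt_pos K i).le) (T.sum_auxWt K)
    fun i _ => mem_univ _)
  calc T.critMin K (fun x => f (evalAt u K x))
      = ∑ i, T.auxWt K i * T.critMin K (fun x => f (evalAt u K x)) := by
        rw [← Finset.sum_mul, T.sum_auxWt, one_mul]
    _ ≤ _ := Finset.sum_le_sum fun i _ => mul_le_mul_of_nonneg_left
        (T.critMin_le K (fun x => f (evalAt u K x)) (T.auxPt_mem K i)) (T.auxWt_pos K i).le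

theorem clip_spec {c mn ε : ℝ} (hmn : mn ≤ c) (hc : ε ≤ c) :
    0 ≤ clip (c - ε) (c - mn) ∧ clip (c - ε) (c - mn) ≤ 1 ∧
      ∀ y, mn ≤ y → ε ≤ clip (c - ε) (c - mn) * (y - c) + c := by
  unfold clip
  split_ifs with h
  · exact ⟨zero_le_one, le_rfl, fun y hy => by linarith⟩
  · have hb : 0 < c - mn := lt_of_le_of_ne (sub_nonneg.2 hmn) (Ne.symm h)
    have h0 : 0 ≤ min 1 ((c - ε) / (c - mn)) :=
      le_min zero_le_one (div_nonneg (sub_nonneg.2 hc) hb.le)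
    refine ⟨h0, min_le_left _ _, fun y hy => ?_⟩
    have h1 : min 1 ((c - ε) / (c - mn)) * (c - mn) ≤ c - ε :=
      (le_div_iff₀ hb).1 (min_le_right _ _)
    have h2 := mul_le_mul_of_nonneg_left hy h0
    linarith

/-! ### The limiter -/

theorem totalDegree_scaleTo {θ c : ℝ} {p : MvPolynomial (Fin 2) ℝ} (hp : p.totalDegree ≤ k) :
    (scaleTo θ c p).totalDegree ≤ k := by
  rw [← MvPolynomial.mem_restrictTotalDegree] at *
  have hC : ∀ a : ℝ, MvPolynomial.C a ∈ MvPolynomial.restrictTotalDegree (Fin 2) ℝ k := fun a => by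
    rw [MvPolynomial.mem_restrictTotalDegree]; simp
  rw [scaleTo, ← MvPolynomial.smul_eq_C_mul]
  exact Submodule.add_mem _ (Submodule.smul_mem _ _ (Submodule.sub_mem _ hp (hC c))) (hC c)

theorem eval_scaleTo (θ c : ℝ) (p : MvPolynomial (Fin 2) ℝ) (x : Pt) :
    MvPolynomial.eval x (scaleTo θ c p) = θ * (MvPolynomial.eval x p - c) + c := by
  simp [scaleTo]

theorem pderiv_scaleTo (θ c : ℝ) (p : MvPolynomial (Fin 2) ℝ) (i : Fin 2) :
    MvPolynomial.pderiv i (scaleTo θ c p) = MvPolynomial.C θ * MvPolynomial.pderiv i p := by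
  simp [scaleTo]

theorem totalDegree_le {u : PW ι} (hu : u ∈ divFreeSpace ι k) (K : ι) (l : Fin 8) :
    (u K l).totalDegree ≤ k :=
  (MvPolynomial.mem_restrictTotalDegree _ _ _).1 ((hu K).1 l)

section limiter

variable {ε : ℝ} {u : PW ι} {K : ι}

theorem hat_zero : T.hat ε u K 0 = scaleTo (T.theta1 ε u K) (T.cellAvg u K 0) (u K 0) :=
  Function.update_self _ _ _

theorem hat_of_ne {l : Fin 8} (hl : l ≠ 0) : T.hat ε u K l = u K l :=
  Function.update_of_ne hl _ _

theorem check_of_mag {l : Fin 8} (hl : l = 4 ∨ l = 5 ∨ l = 6) : T.check ε u K l = u K l :=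
  if_pos hl

theorem check_of_not_mag {l : Fin 8} (hl : ¬ (l = 4 ∨ l = 5 ∨ l = 6)) :
    T.check ε u K l = scaleTo (T.theta2 ε u K) (T.cellAvg u K l) (T.hat ε u K l) :=
  if_neg hl

theorem totalDegree_hat (hu : ∀ l, (u K l).totalDegree ≤ k) (l : Fin 8) :
    (T.hat ε u K l).totalDegree ≤ k := by
  by_cases hl : l = 0
  · subst hl
    rw [hat_zero]
    exact totalDegree_scaleTo (hu 0)
  · rw [hat_of_ne _ hl]
    exact hu l

theorem totalDegree_check (hu : ∀ l, (u K l).totalDegree ≤ k) (l : Fin 8) :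
    (T.check ε u K l).totalDegree ≤ k := by
  by_cases hl : l = 4 ∨ l = 5 ∨ l = 6
  · rw [check_of_mag _ hl]
    exact hu l
  · rw [check_of_not_mag _ hl]
    exact totalDegree_scaleTo (T.totalDegree_hat hu l)

theorem cellAvg_hat : T.cellAvg (T.hat ε u) K = T.cellAvg u K := by
  funext l
  rw [cellAvg_apply]
  by_cases hl : l = 0
  · subst hl
    rw [hat_zero]
    exact PolygonalCell.avg_scaleTo _ _ _ rfl
  · rw [hat_of_ne _ hl]
    rfl

theorem cellAvg_check : T.cellAvg (T.check ε u) K = T.cellAvg u K := by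
  funext l
  rw [cellAvg_apply]
  by_cases hl : l = 4 ∨ l = 5 ∨ l = 6
  · rw [check_of_mag _ hl]
    rfl
  · rw [check_of_not_mag _ hl]
    exact PolygonalCell.avg_scaleTo _ _ _ (congrFun T.cellAvg_hat l)

theorem cellAvg_limiter : T.cellAvg (T.limiter ε u) K = T.cellAvg u K := by
  funext l
  exact PolygonalCell.avg_scaleTo _ _ _ (congrFun T.cellAvg_check l)

theorem evalAt_limiter (x : Pt) : evalAt (T.limiter ε u) K x
    = (1 - T.theta3 ε u K) • T.cellAvg u K
      + T.theta3 ε u K • evalAt (T.check ε u) K x := by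
  funext l
  simp only [evalAt, limiter, eval_scaleTo, Pi.add_apply, Pi.smul_apply, smul_eq_mul]
  ring

/-- The first two steps do not touch `B`, and the third scales its components by a common factor per
cell, so the divergence is only multiplied by that factor. -/
theorem limiter_mem_divFreeSpace (hu : u ∈ divFreeSpace ι k) :
    T.limiter ε u ∈ divFreeSpace ι k := by
  refine fun K => ⟨fun l => ?_, ?_⟩
  · rw [MvPolynomial.mem_restrictTotalDegree]
    exact totalDegree_scaleTo (T.totalDegree_check (totalDegree_le hu K) l)
  · simp only [limiter, pderiv_scaleTo]
    rw [check_of_mag _ (by decide), check_of_mag _ (by decide), ← mul_add, (hu K).2, mul_zero]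

/-- The first two limiting steps enforce the bounds on the density and on `q`. -/
theorem check_bounds (hu : ∀ l, (u K l).totalDegree ≤ k) (hD : ε ≤ T.cellAvg u K 0)
    (hq : ε ≤ qFun (T.cellAvg u K)) {x : Pt} (hx : x ∈ T.critPts K) :
    ε ≤ evalAt (T.check ε u) K x 0 ∧ ε ≤ qFun (evalAt (T.check ε u) K x) := by
  have hD1 : T.critMin K (fun x => evalAt u K x 0) ≤ T.cellAvg u K 0 :=
    T.critMin_le_of_concaveOn (f := fun U => U 0)
      ((LinearMap.proj (R := ℝ) (φ := fun _ : Fin 8 => ℝ) 0).concaveOn convex_univ) hu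
  have h1 : ε ≤ evalAt (T.hat ε u) K x 0 := by
    have := (clip_spec hD1 hD).2.2 _ (T.critMin_le K (fun x => evalAt u K x 0) hx)
    rw [evalAt, hat_zero, eval_scaleTo]
    exact this
  have hq1 : T.critMin K (fun x => qFun (evalAt (T.hat ε u) K x)) ≤ qFun (T.cellAvg u K) := by
    have := T.critMin_le_of_concaveOn concaveOn_qFun (T.totalDegree_hat (ε := ε) hu)
    rwa [cellAvg_hat] at this
  obtain ⟨h20, h21, h2⟩ := clip_spec hq1 hq
  have h3 := h2 _ (T.critMin_le K (fun x => qFun (evalAt (T.hat ε u) K x)) hx)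
  change 0 ≤ T.theta2 ε u K at h20
  change T.theta2 ε u K ≤ 1 at h21
  change ε ≤ T.theta2 ε u K * _ + _ at h3
  have hev : ∀ l : Fin 8, ¬ (l = 4 ∨ l = 5 ∨ l = 6) → evalAt (T.check ε u) K x l
      = ((1 - T.theta2 ε u K) • T.cellAvg u K + T.theta2 ε u K • evalAt (T.hat ε u) K x) l := by
    intro l hl
    rw [evalAt, check_of_not_mag _ hl, eval_scaleTo]
    simp only [Pi.add_apply, Pi.smul_apply, smul_eq_mul, evalAt]
    ring
  constructor
  · rw [hev 0 (by decide)]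
    simp only [Pi.add_apply, Pi.smul_apply, smul_eq_mul]
    nlinarith
  · rw [qFun_congr (hev 0 (by decide)) (hev 1 (by decide)) (hev 2 (by decide))
      (hev 3 (by decide)) (hev 7 (by decide))]
    have := concaveOn_qFun.2 (mem_univ (T.cellAvg u K)) (mem_univ (evalAt (T.hat ε u) K x))
      (sub_nonneg.2 h21) h20 (by ring)
    simp only [smul_eq_mul] at this
    linarith

/-- Where Ψ_ε is negative, continuity along the segment from the average yields a root. Linearity of
`D` and concavity of `q` keep their bounds on the segment, so the root lies in `AdmEps ε`. -/
theorem thetaPt_spec {H : ℝ → ℝ → ℝ} (hH : IsCausalEOS H) (hε : 0 < ε)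
    (hu : ∀ l, (u K l).totalDegree ≤ k) (havg : T.cellAvg u K ∈ AdmEps ε) {x : Pt}
    (hx : x ∈ T.critPts K) : 0 ≤ T.thetaPt ε u K x ∧
      (1 - T.thetaPt ε u K x) • T.cellAvg u K
        + T.thetaPt ε u K x • evalAt (T.check ε u) K x ∈ Adm H := by
  obtain ⟨hD, hq⟩ := T.check_bounds hu havg.1 havg.2.1 hx
  set V := evalAt (T.check ε u) K x with hV
  by_cases hψ : 0 ≤ psiEps ε V
  · have ht : T.thetaPt ε u K x = 1 := if_pos hψ
    rw [ht, sub_self, zero_smul, zero_add, one_smul]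
    exact ⟨zero_le_one, admEps_subset_adm hH hε ⟨hD, hq, hψ⟩⟩
  · have hex : ∃ t : ℝ, t ∈ Ico (0 : ℝ) 1 ∧
        psiEps ε ((1 - t) • T.cellAvg u K + t • V) = 0 := by
      have hc : Continuous fun t : ℝ => psiEps ε ((1 - t) • T.cellAvg u K + t • V) :=
        (continuous_psiEps ε).comp (by fun_prop)
      obtain ⟨t, ht, h0⟩ := intermediate_value_Icc' zero_le_one hc.continuousOn
        (show (0 : ℝ) ∈ Icc _ _ from ⟨by simpa using (not_le.1 hψ).le, by simpa using havg.2.2⟩)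
      refine ⟨t, ⟨ht.1, lt_of_le_of_ne ht.2 ?_⟩, h0⟩
      rintro rfl
      apply hψ
      simp only [sub_self, zero_smul, zero_add, one_smul] at h0
      exact h0.ge
    have ht : T.thetaPt ε u K x = Classical.epsilon fun t : ℝ => t ∈ Ico (0 : ℝ) 1 ∧
        psiEps ε ((1 - t) • T.cellAvg u K + t • V) = 0 := if_neg hψ
    obtain ⟨⟨h0, h1⟩, h2⟩ := Classical.epsilon_spec hex
    rw [← ht] at h0 h1 h2
    refine ⟨h0, admEps_subset_adm hH hε ⟨?_, ?_, h2.ge⟩⟩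
    · have := havg.1
      simp only [Pi.add_apply, Pi.smul_apply, smul_eq_mul]
      nlinarith
    · have h3 := concaveOn_qFun.2 (mem_univ (T.cellAvg u K)) (mem_univ V)
        (sub_nonneg.2 h1.le) h0 (by ring)
      have := havg.2.1
      simp only [smul_eq_mul] at h3
      nlinarith

theorem limiter_mem_strongSet {H : ℝ → ℝ → ℝ} (hH : IsCausalEOS H) (hu : u ∈ T.weakSet H)
    (hε : 0 < ε) (havg : ∀ K, T.cellAvg u K ∈ AdmEps ε) : T.limiter ε u ∈ T.strongSet H := by
  refine ⟨⟨T.limiter_mem_divFreeSpace hu.1, fun K => ?_⟩, fun K x hx => ?_⟩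
  · rw [cellAvg_limiter]
    exact hu.2 K
  · have hdeg := totalDegree_le hu.1 K
    obtain ⟨h0, h1⟩ := T.thetaPt_spec hH hε hdeg (havg K) hx
    have h2 : 0 ≤ T.theta3 ε u K :=
      T.le_critMin K _ fun y hy => (T.thetaPt_spec hH hε hdeg (havg K) hy).1
    have h3 : T.theta3 ε u K ≤ T.thetaPt ε u K x := T.critMin_le K _ hx
    rw [evalAt_limiter]
    set t := T.thetaPt ε u K x
    set θ := T.theta3 ε u K
    -- Since θ₃ ≤ θ̃(x), the limited value lies between the average and the pointwise limited state.
    -- Convexity of `Adm H` then suffices, without any concavity of Ψ_ε.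
    rcases h0.eq_or_lt with h4 | h4
    · have : θ = 0 := le_antisymm (h3.trans h4.ge) h2
      rw [this]
      simpa using hu.2 K
    · have hs : 0 ≤ θ / t := by positivity
      have hs1 : θ / t ≤ 1 := (div_le_one h4).2 h3
      have := convex_adm hH (hu.2 K) h1 (sub_nonneg.2 hs1) hs (by ring)
      convert this using 1
      rw [smul_add, smul_smul, smul_smul, div_mul_cancel₀ _ h4.ne', ← add_assoc, ← add_smul]
      congr 2
      field_simp
      ring

end limiter

end Discretization

/-! ### Numerical flux and source at one edge quadrature point -/

theorem prim_spec {H : ℝ → ℝ → ℝ} {U : State} (hU : U ∈ Adm H) :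
    (prim H U).Physical H ∧ (prim H U).toCons H = U := by
  have h : ∃ w : Prim, w.Physical H ∧ w.toCons H = U := hU
  rw [prim, dif_pos h]
  exact h.choose_spec

theorem prim_mag {H : ℝ → ℝ → ℝ} {U : State} (hU : U ∈ Adm H) : (prim H U).B = magOf U := by
  have h : magOf ((prim H U).toCons H) = (prim H U).B := by
    funext i; fin_cases i <;> rfl
  rw [← h, (prim_spec hU).2]

namespace Discretization

variable {H : ℝ → ℝ → ℝ} {U Ui Ue : State} {n : Pt} {v B : Fin 3 → ℝ}

theorem normalFlux_lt (hH : IsCausalEOS H) (hU : U ∈ Adm H) (hn : n 0 ^ 2 + n 1 ^ 2 = 1)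
    (hv : v ⬝ᵥ v < 1) :
    nStar v B ⬝ᵥ normalFlux H n U + (n 0 * v 0 + n 1 * v 1) * pStar v B
      - normalMag n U * (v ⬝ᵥ B) < nStar v B ⬝ᵥ U + pStar v B := by
  obtain ⟨hw, hU'⟩ := prim_spec hU
  -- The inward unit normal as causal direction gives the upper bound for the flux.
  have ha : (![-n 0, -n 1, 0] : Fin 3 → ℝ) ⬝ᵥ ![-n 0, -n 1, 0] ≤ 1 := by
    simp only [dotProduct, Fin.sum_univ_three, Matrix.cons_val]
    nlinarith
  have h := Prim.split_pos hH hw B hv ha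
  rw [hU', Fin.sum_univ_three, prim_mag hU] at h
  simp only [Matrix.cons_val] at h
  simp only [normalFlux, normalMag, dotProduct_add, dotProduct_smul, smul_eq_mul]
  linarith

theorem abs_normalFlux_zero_lt (hU : U ∈ Adm H) (hn : n 0 ^ 2 + n 1 ^ 2 = 1) :
    |normalFlux H n U 0| < U 0 := by
  obtain ⟨hw, hU'⟩ := prim_spec hU
  have h0 : U 0 = (prim H U).rho * (prim H U).lorentz := (congrFun hU' 0).symm
  have hpos : 0 < U 0 := by
    rw [h0]; exact mul_pos hw.1 hw.lorentz_pos
  have h1 : normalFlux H n U 0 = U 0 * (n 0 * (prim H U).v 0 + n 1 * (prim H U).v 1) := by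
    rw [h0]
    simp only [normalFlux, Prim.flux, pack, Pi.add_apply, Pi.smul_apply, smul_eq_mul,
      Matrix.cons_val]
    ring
  have hv := hw.dot_lt_one
  simp only [dotProduct, Fin.sum_univ_three] at hv
  set v := (prim H U).v
  have h2 : (n 0 * v 0 + n 1 * v 1) ^ 2 < 1 := by
    have : (n 0 * v 0 + n 1 * v 1) ^ 2 + (n 0 * v 1 - n 1 * v 0) ^ 2
        = v 0 ^ 2 + v 1 ^ 2 := by
      linear_combination (v 0 ^ 2 + v 1 ^ 2) * hn
    nlinarith [sq_nonneg (n 0 * v 1 - n 1 * v 0), sq_nonneg (v 2)]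
  rw [h1, abs_mul, abs_of_pos hpos]
  exact mul_lt_of_lt_one_right hpos ((sq_lt_one_iff_abs_lt_one _).1 h2)

/-- Lower bound for the contribution of one edge quadrature point to a linear constraint. -/
theorem edge_contribution (hH : IsCausalEOS H) (hi : Ui ∈ Adm H) (he : Ue ∈ Adm H)
    (hn : n 0 ^ 2 + n 1 ^ 2 = 1) (hv : v ⬝ᵥ v < 1) :
    -(visc + 1 / 2 * |normalMag n Ui - normalMag n Ue| /
        √((prim H Ui).rho * (prim H Ui).enthalpy H)) * (nStar v B ⬝ᵥ Ui + pStar v B)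
      + ((n 0 * v 0 + n 1 * v 1) * pStar v B - normalMag n Ui * (v ⬝ᵥ B))
    < -(nStar v B ⬝ᵥ numFlux H Ui Ue n)
      - 1 / 2 * (normalMag n Ue - normalMag n Ui) * (nStar v B ⬝ᵥ (prim H Ui).source) := by
  have h1 := normalFlux_lt (B := B) hH hi hn hv
  have h2 := normalFlux_lt (B := B) hH he hn hv
  obtain ⟨hw, hU'⟩ := prim_spec hi
  have h3 := Prim.source_le hH hw B hv
  rw [hU'] at h3
  have hκ : 0 < √((prim H Ui).rho * (prim H Ui).enthalpy H) := by
    have h := hH.one_add_lt hw.2.1 hw.1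
    have h' : 0 < (prim H Ui).p / (prim H Ui).rho := div_pos hw.2.1 hw.1
    have h4 : 0 < (prim H Ui).enthalpy H := by
      rw [Prim.enthalpy]; linarith
    exact Real.sqrt_pos.2 (mul_pos hw.1 h4)
  set κ := √((prim H Ui).rho * (prim H Ui).enthalpy H)
  set φ := nStar v B ⬝ᵥ Ui + pStar v B with hφ
  set t := nStar v B ⬝ᵥ (prim H Ui).source
  set d := normalMag n Ui - normalMag n Ue with hd
  -- Viscosity cancels the exterior functional. The defect left over is `d/2 · (v·B)` relative to
  -- the interior one, and with the source it forms `d/2 · (t + v·B)`, which `Prim.source_le`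
  -- controls.
  have h4 : -(d * (t + v ⬝ᵥ B)) ≤ |d| / κ * φ := by
    have h5 : |t + v ⬝ᵥ B| ≤ φ / κ := by
      rw [le_div_iff₀ hκ, mul_comm]; exact h3
    calc -(d * (t + v ⬝ᵥ B)) ≤ |d * (t + v ⬝ᵥ B)| := neg_le_abs _
      _ = |d| * |t + v ⬝ᵥ B| := abs_mul _ _
      _ ≤ |d| * (φ / κ) := by gcongr
      _ = _ := by ring
  have h6 : nStar v B ⬝ᵥ numFlux H Ui Ue n = 1 / 2 * (nStar v B ⬝ᵥ normalFlux H n Ui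
      + nStar v B ⬝ᵥ normalFlux H n Ue - (nStar v B ⬝ᵥ Ue - nStar v B ⬝ᵥ Ui)) := by
    simp only [numFlux, visc, dotProduct_smul, dotProduct_sub, dotProduct_add, smul_eq_mul,
      one_mul]
  have h7 : normalMag n Ue - normalMag n Ui = -d := by rw [hd]; ring
  have h8 : normalMag n Ue = normalMag n Ui - d := by rw [hd]; ring
  have h9 : 1 / 2 * |d| / κ * φ = 1 / 2 * (|d| / κ * φ) := by ring
  rw [h6, h7, visc]
  rw [h8] at h2
  linarith

theorem edge_contribution_density (hi : Ui ∈ Adm H) (he : Ue ∈ Adm H)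
    (hn : n 0 ^ 2 + n 1 ^ 2 = 1) {s : ℝ} (hs : 0 ≤ s) :
    -(visc + s) * Ui 0 < -(numFlux H Ui Ue n 0) := by
  have h1 := abs_lt.1 (abs_normalFlux_zero_lt hi hn)
  have h2 := abs_lt.1 (abs_normalFlux_zero_lt he hn)
  have h3 : 0 < Ui 0 := by linarith
  have h4 := mul_nonneg hs h3.le
  simp only [numFlux, visc, Pi.smul_apply, Pi.add_apply, Pi.sub_apply, smul_eq_mul, one_mul]
  linarith

variable {ι : Type*} {k : ℕ} (T : Discretization ι k)

theorem dotProduct_cellAvg (c : State) (u : PW ι) (K : ι) :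
    c ⬝ᵥ T.cellAvg u K
      = 1 / (T.mesh.cell K).area * ∫ x in (T.mesh.cell K).carrier, evalAt u K x ⬝ᵥ c := by
  simp only [dotProduct]
  rw [integral_finsetSum, Finset.mul_sum]
  · refine Finset.sum_congr rfl fun l _ => ?_
    rw [integral_mul_const, cellAvg]
    ring
  · intro l _
    exact ((T.mesh.cell K).integrableOn_eval (u K l)).mul_const _

theorem weakForm_const (bc : BoundaryRule T) (u : PW ι) (K : ι) (c : State) :
    T.weakForm H bc u K (fun _ l => MvPolynomial.C (c l))
      = ∑ j, (T.mesh.cell K).len j * ∑ q, T.edgeRule.weight q *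
        (-(c ⬝ᵥ numFlux H (T.intState u K j q) (T.extState bc u K j q) ((T.mesh.cell K).normal j))
          - 1 / 2 * (normalMag ((T.mesh.cell K).normal j) (T.extState bc u K j q)
              - normalMag ((T.mesh.cell K).normal j) (T.intState u K j q)) *
            (c ⬝ᵥ (prim H (T.intState u K j q)).source)) := by
  have hev : ∀ x, evalAt (fun (_ : ι) l => MvPolynomial.C (c l)) K x = c := fun x => by
    funext l; simp [evalAt]
  simp only [weakForm, J1, J2, J3, hev, MvPolynomial.pderiv_C, map_zero, mul_zero, add_zero,
    Finset.sum_const_zero, dotProduct_comm c]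
  rw [Finset.mul_sum, ← Finset.sum_neg_distrib, ← Finset.sum_add_distrib]
  refine Finset.sum_congr rfl fun j _ => ?_
  rw [← mul_neg, mul_left_comm, ← mul_add, Finset.mul_sum, ← Finset.sum_neg_distrib,
    ← Finset.sum_add_distrib]
  congr 1
  exact Finset.sum_congr rfl fun q _ => by ring

theorem const_mem_divFreeSpace (c : State) :
    (fun _ l => MvPolynomial.C (c l) : PW ι) ∈ divFreeSpace ι k := fun K =>
  ⟨fun l => by rw [MvPolynomial.mem_restrictTotalDegree]; simp, by simp⟩

theorem extState_mem {bc : BoundaryRule T} {u : PW ι} (hu : u ∈ T.strongSet H)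
    (hbc : ∀ K j q, T.mesh.neighbor K j = none → bc u K j q ∈ Adm H) (K : ι)
    (j : Fin (T.mesh.cell K).nv) (q : Fin T.edgeRule.Q) : T.extState bc u K j q ∈ Adm H := by
  unfold extState
  split
  · rename_i e he
    obtain ⟨K', j'⟩ := e
    obtain ⟨-, hs, ht⟩ := T.mesh.neighbor_some K j K' j' he
    -- The neighbour runs through the edge in the opposite direction, so symmetry of the rule
    -- identifies node `q` here with node `q.rev` there.
    have hpt : T.edgeNode K j q = T.edgeNode K' j' q.rev := by
      simp only [edgeNode, PolygonalCell.edgePt, hs, ht, T.edgeRule.node_rev]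
      module
    rw [hpt]
    exact hu.2 K' _ (T.edgeNode_mem K' j' q.rev)
  · rename_i he
    exact hbc K j q he

theorem sigma_nonneg (bc : BoundaryRule T) (u : PW ι) (K : ι) (j : Fin (T.mesh.cell K).nv)
    (q : Fin T.edgeRule.Q) : 0 ≤ T.sigma H bc u K j q := by
  unfold sigma; positivity

/-! ### Forward Euler step for cell averages -/

section euler

variable [Fintype ι] {bc : BoundaryRule T} {u : PW ι} {τ : ℝ} {K : ι}

/-- Propagation of a positive affine functional by one forward Euler step. -/
theorem euler_functional_pos (hu : u ∈ T.strongSet H) (hτ : 0 < τ)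
    (hcfl : ∀ j q, τ * (T.edgeRule.weight q * (visc + T.sigma H bc u K j q) *
      (T.mesh.cell K).len j) ≤ (T.cellRule K).edgeWeight j q * (T.mesh.cell K).area)
    (c : State) (p : ℝ) (hc : ∀ U ∈ Adm H, 0 < c ⬝ᵥ U + p)
    (r : Fin (T.mesh.cell K).nv → Fin T.edgeRule.Q → ℝ)
    (hr : ∑ j, (T.mesh.cell K).len j * ∑ q, T.edgeRule.weight q * r j q = 0)
    (hedge : ∀ j q, -(visc + T.sigma H bc u K j q) * (c ⬝ᵥ T.intState u K j q + p) + r j q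
      < -(c ⬝ᵥ numFlux H (T.intState u K j q) (T.extState bc u K j q) ((T.mesh.cell K).normal j))
          - 1 / 2 * (normalMag ((T.mesh.cell K).normal j) (T.extState bc u K j q)
              - normalMag ((T.mesh.cell K).normal j) (T.intState u K j q)) *
            (c ⬝ᵥ (prim H (T.intState u K j q)).source)) :
    0 < c ⬝ᵥ (T.cellAvg u K + τ • T.cellAvg (T.Lh H bc u) K) + p := by
  obtain ⟨hL, hLw⟩ : T.IsSpatialOperator H bc u (T.Lh H bc u) :=
    Classical.epsilon_spec (T.exists_isSpatialOperator H bc u)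
  have h1 := hLw K _ (const_mem_divFreeSpace c)
  have hev : ∀ x, evalAt (fun (_ : ι) l => MvPolynomial.C (c l)) K x = c := fun x => by
    funext l; simp [evalAt]
  simp only [hev] at h1
  rw [weakForm_const] at h1
  have hA := (T.mesh.cell K).area_pos
  have hlen := (T.mesh.cell K).len_pos
  have hω := T.edgeRule.weight_pos
  obtain ⟨q₀⟩ := T.edgeRule.nonempty
  have hne : (Finset.univ : Finset (Fin T.edgeRule.Q)).Nonempty := ⟨q₀, Finset.mem_univ _⟩
  have hnej : (Finset.univ : Finset (Fin (T.mesh.cell K).nv)).Nonempty :=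
    ⟨⟨0, by have := (T.mesh.cell K).three_le; omega⟩, Finset.mem_univ _⟩
  set φ : Fin (T.mesh.cell K).nv → Fin T.edgeRule.Q → ℝ :=
    fun j q => c ⬝ᵥ T.intState u K j q + p with hφ
  have h2 : -∑ j, (T.mesh.cell K).len j * ∑ q, T.edgeRule.weight q *
      ((visc + T.sigma H bc u K j q) * φ j q)
      < ∫ x in (T.mesh.cell K).carrier, evalAt (T.Lh H bc u) K x ⬝ᵥ c := by
    rw [h1]
    refine lt_of_eq_of_lt ?_ (Finset.sum_lt_sum_of_nonempty hnej fun j _ =>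
      mul_lt_mul_of_pos_left (Finset.sum_lt_sum_of_nonempty hne fun q _ =>
        mul_lt_mul_of_pos_left (hedge j q) (hω q)) (hlen j))
    have e : ∀ j, ∑ q, T.edgeRule.weight q * (-(visc + T.sigma H bc u K j q) * φ j q + r j q)
        = -∑ q, T.edgeRule.weight q * ((visc + T.sigma H bc u K j q) * φ j q)
          + ∑ q, T.edgeRule.weight q * r j q := fun j => by
      rw [← Finset.sum_neg_distrib, ← Finset.sum_add_distrib]
      exact Finset.sum_congr rfl fun q _ => by ring
    change _ = ∑ j, (T.mesh.cell K).len j * ∑ q, T.edgeRule.weight q *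
      (-(visc + T.sigma H bc u K j q) * φ j q + r j q)
    simp only [e, mul_add (_ : ℝ) (-_), mul_neg, Finset.sum_add_distrib, Finset.sum_neg_distrib]
    rw [hr, add_zero]
  -- The CFL condition says that the auxiliary weight at an edge point covers the loss factor there,
  -- and φ is nonnegative at that point.
  have h3 : τ / (T.mesh.cell K).area * ∑ j, (T.mesh.cell K).len j * ∑ q, T.edgeRule.weight q *
      ((visc + T.sigma H bc u K j q) * φ j q)
      ≤ ∑ j, ∑ q, (T.cellRule K).edgeWeight j q * φ j q := by
    rw [Finset.mul_sum]
    refine Finset.sum_le_sum fun j _ => ?_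
    rw [Finset.mul_sum, Finset.mul_sum]
    refine Finset.sum_le_sum fun q _ => ?_
    have hφ0 : 0 ≤ φ j q := (hc _ (hu.2 K _ (T.edgeNode_mem K j q))).le
    have h4 : τ * (T.edgeRule.weight q * (visc + T.sigma H bc u K j q) *
      (T.mesh.cell K).len j) / (T.mesh.cell K).area ≤ (T.cellRule K).edgeWeight j q :=
      (div_le_iff₀ hA).2 (hcfl j q)
    refine le_trans (le_of_eq ?_) (mul_le_mul_of_nonneg_right h4 hφ0)
    ring
  -- The remaining auxiliary points contribute nonnegatively. Strictness of the conclusion comes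
  -- from the edge estimate.
  have h5 : ∑ j, ∑ q, (T.cellRule K).edgeWeight j q * φ j q ≤ c ⬝ᵥ T.cellAvg u K + p := by
    have e : c ⬝ᵥ T.cellAvg u K + p
        = ∑ i, T.auxWt K i * (c ⬝ᵥ evalAt u K (T.auxPt K i) + p) := by
      simp only [mul_add, Finset.sum_add_distrib, ← Finset.sum_mul, T.sum_auxWt, one_mul]
      rw [T.cellAvg_eq_sum (totalDegree_le hu.1.1 K), dotProduct_sum]
      simp only [dotProduct_smul, smul_eq_mul]
    rw [e, Fintype.sum_sum_type, Fintype.sum_prod_type]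
    refine le_add_of_le_of_nonneg le_rfl (Finset.sum_nonneg fun i _ => ?_)
    exact mul_nonneg (T.auxWt_pos K _).le (hc _ (hu.2 K _ (T.auxPt_mem K _))).le
  have h6 := mul_lt_mul_of_pos_left h2 (div_pos hτ hA)
  rw [dotProduct_add, dotProduct_smul, T.dotProduct_cellAvg c (T.Lh H bc u), smul_eq_mul,
    ← mul_assoc, mul_one_div]
  linarith

/-- One forward Euler step preserves admissibility of the cell averages. -/
theorem euler_mem_adm (hH : IsCausalEOS H) (hu : u ∈ T.strongSet H)
    (hbc : ∀ K j q, T.mesh.neighbor K j = none → bc u K j q ∈ Adm H) (hτ : 0 < τ)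
    (hcfl : ∀ j q, τ * (T.edgeRule.weight q * (visc + T.sigma H bc u K j q) *
      (T.mesh.cell K).len j) ≤ (T.cellRule K).edgeWeight j q * (T.mesh.cell K).area) :
    T.cellAvg u K + τ • T.cellAvg (T.Lh H bc u) K ∈ Adm H := by
  have hint : ∀ j q, T.intState u K j q ∈ Adm H := fun j q => hu.2 K _ (T.edgeNode_mem K j q)
  have hext := fun j q => T.extState_mem hu hbc K j q
  rw [mem_adm_iff hH]
  constructor
  · have h := T.euler_functional_pos hu hτ hcfl (Pi.single 0 1) 0
      (fun U hU => by simpa using ((mem_adm_iff hH U).1 hU).1) 0 (by simp) fun j q => by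
        have h0 : (prim H (T.intState u K j q)).source 0 = 0 := rfl
        simpa [h0] using edge_contribution_density (hint j q) (hext j q)
          ((T.mesh.cell K).normal_sq j) (T.sigma_nonneg (H := H) bc u K j q)
    simpa using h
  · intro v B hv
    refine T.euler_functional_pos hu hτ hcfl (nStar v B) (pStar v B)
      (fun U hU => ((mem_adm_iff hH U).1 hU).2 v B hv)
      (fun j q => ((T.mesh.cell K).normal j 0 * v 0 + (T.mesh.cell K).normal j 1 * v 1)
        * pStar v B - normalMag ((T.mesh.cell K).normal j) (T.intState u K j q) * (v ⬝ᵥ B)) ?_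
      fun j q => edge_contribution hH (hint j q) (hext j q) ((T.mesh.cell K).normal_sq j) hv
    -- The `pStar` part of the remainder vanishes because the length-weighted normals of a closed
    -- polygon sum to zero, the magnetic part by the discrete divergence theorem.
    have h0 := (T.mesh.cell K).sum_len_mul_normal 0
    have h1 := (T.mesh.cell K).sum_len_mul_normal 1
    have h2 := (T.mesh.cell K).sum_flux_eq_zero T.edgeRule (totalDegree_le hu.1.1 K 4)
      (totalDegree_le hu.1.1 K 5) (hu.1.1 K).2
    have h3 : ∀ j, ∑ q, T.edgeRule.weight q *
        (((T.mesh.cell K).normal j 0 * v 0 + (T.mesh.cell K).normal j 1 * v 1) * pStar v B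
          - normalMag ((T.mesh.cell K).normal j) (T.intState u K j q) * (v ⬝ᵥ B))
        = ((T.mesh.cell K).normal j 0 * v 0 + (T.mesh.cell K).normal j 1 * v 1) * pStar v B
          - (∑ q, T.edgeRule.weight q *
            normalMag ((T.mesh.cell K).normal j) (T.intState u K j q)) * (v ⬝ᵥ B) := fun j => by
      simp only [mul_sub, Finset.sum_sub_distrib]
      rw [← Finset.sum_mul, T.edgeRule.sum_weight, one_mul, Finset.sum_mul]
      congr 1
      exact Finset.sum_congr rfl fun q _ => by ring
    have h4 : ∑ j, (T.mesh.cell K).len j * ∑ q, T.edgeRule.weight q *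
        normalMag ((T.mesh.cell K).normal j) (T.intState u K j q) = 0 := h2
    calc _ = (∑ j, (T.mesh.cell K).len j * (T.mesh.cell K).normal j 0) * (v 0 * pStar v B)
          + (∑ j, (T.mesh.cell K).len j * (T.mesh.cell K).normal j 1) * (v 1 * pStar v B)
          - (∑ j, (T.mesh.cell K).len j * ∑ q, T.edgeRule.weight q *
            normalMag ((T.mesh.cell K).normal j) (T.intState u K j q)) * (v ⬝ᵥ B) := by
          rw [Finset.sum_mul, Finset.sum_mul, Finset.sum_mul, ← Finset.sum_add_distrib,
            ← Finset.sum_sub_distrib]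
          exact Finset.sum_congr rfl fun j _ => by rw [h3]; ring
      _ = 0 := by rw [h0, h1, h4]; ring

end euler

/-! ### Averages of the projected initial datum -/

/-- Constants supported on one cell are test functions, so the projection keeps the cell averages of
the datum. Strict affine constraints survive averaging since cells have positive measure. -/
theorem cellAvg_Pw_mem [Fintype ι] (hH : IsCausalEOS H) {U₀ : Pt → State}
    (hL2 : ∀ l, MemLp (fun x => U₀ x l) 2 (volume.restrict T.mesh.domain))
    (hU₀ : ∀ x ∈ T.mesh.domain, U₀ x ∈ Adm H) : T.Pw U₀ ∈ T.weakSet H := by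
  classical
  obtain ⟨hv, hvw⟩ : T.IsL2Projection U₀ (T.Pw U₀) :=
    Classical.epsilon_spec (T.exists_isL2Projection U₀ hL2)
  refine ⟨hv, fun K => ?_⟩
  have hsub : (T.mesh.cell K).carrier ⊆ T.mesh.domain :=
    subset_iUnion (fun K => (T.mesh.cell K).carrier) K
  have hfin : volume (T.mesh.cell K).carrier < ⊤ := (T.mesh.cell K).isCompact.measure_lt_top
  have : IsFiniteMeasure (volume.restrict (T.mesh.cell K).carrier) := ⟨by simpa using hfin⟩
  have hA := (T.mesh.cell K).area_pos
  have hint : ∀ c : State, IntegrableOn (fun x => U₀ x ⬝ᵥ c) (T.mesh.cell K).carrier := fun c =>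
    integrable_finsetSum _ fun l _ => (((hL2 l).mono_measure
      (Measure.restrict_mono hsub le_rfl)).integrable (by norm_num)).mul_const _
  have havg : ∀ c : State, c ⬝ᵥ T.cellAvg (T.Pw U₀) K
      = 1 / (T.mesh.cell K).area * ∫ x in (T.mesh.cell K).carrier, U₀ x ⬝ᵥ c := fun c => by
    set w : PW ι := Pi.single K fun l => MvPolynomial.C (c l) with hw
    have hwm : w ∈ divFreeSpace ι k := fun K' => by
      by_cases hK : K' = K
      · subst hK
        simpa [hw] using const_mem_divFreeSpace (ι := ι) (k := k) c K'
      · simp [hw, hK]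
    have hwK : ∀ x, evalAt w K x = c := fun x => by
      funext l; simp [evalAt, hw]
    have hwne : ∀ K' ≠ K, ∀ x, evalAt w K' x = 0 := fun K' hK x => by
      funext l; simp [evalAt, hw, hK]
    have h := hvw w hwm
    rw [Finset.sum_eq_single K (fun K' _ hK => by simp [hwne K' hK]) (by simp),
      Finset.sum_eq_single K (fun K' _ hK => by simp [hwne K' hK]) (by simp)] at h
    simp only [hwK] at h
    rw [dotProduct_cellAvg, h]
  have hpos : ∀ (c : State) (p : ℝ), (∀ U ∈ Adm H, 0 < c ⬝ᵥ U + p) →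
      0 < c ⬝ᵥ T.cellAvg (T.Pw U₀) K + p := fun c p hc => by
    have hi : IntegrableOn (fun x => U₀ x ⬝ᵥ c + p) (T.mesh.cell K).carrier :=
      (hint c).add (integrable_const p)
    have hp : ∀ x ∈ (T.mesh.cell K).carrier, 0 < U₀ x ⬝ᵥ c + p := fun x hx => by
      rw [dotProduct_comm]
      exact hc _ (hU₀ x (hsub hx))
    have h1 : 0 < ∫ x in (T.mesh.cell K).carrier, (U₀ x ⬝ᵥ c + p) := by
      rw [setIntegral_pos_iff_support_of_nonneg_ae _ hi]
      · have hs : (T.mesh.cell K).carrier ⊆ Function.support fun x => U₀ x ⬝ᵥ c + p :=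
          fun x hx => (hp x hx).ne'
        rw [inter_eq_self_of_subset_right hs]
        exact (ENNReal.toReal_pos_iff.1 hA).1
      · exact ae_restrict_of_forall_mem (T.mesh.cell K).isCompact.measurableSet
          fun x hx => (hp x hx).le
    rw [integral_add (hint c) (integrable_const p), setIntegral_const, smul_eq_mul] at h1
    change 0 < _ + (T.mesh.cell K).area * p at h1
    have e : c ⬝ᵥ T.cellAvg (T.Pw U₀) K + p = 1 / (T.mesh.cell K).area *
        ((∫ x in (T.mesh.cell K).carrier, U₀ x ⬝ᵥ c) + (T.mesh.cell K).area * p) := by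
      rw [havg]; field_simp
    rw [e]
    positivity
  rw [mem_adm_iff hH]
  refine ⟨?_, fun v B hv => hpos _ _ fun U hU => ((mem_adm_iff hH U).1 hU).2 v B hv⟩
  simpa using hpos (Pi.single 0 1) 0 fun U hU => by simpa using ((mem_adm_iff hH U).1 hU).1

theorem cellAvg_add (u w : PW ι) (K : ι) : T.cellAvg (u + w) K = T.cellAvg u K + T.cellAvg w K :=
  funext fun _ => PolygonalCell.avg_add _ _ _

theorem cellAvg_smul (c : ℝ) (u : PW ι) (K : ι) : T.cellAvg (c • u) K = c • T.cellAvg u K :=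
  funext fun l => by
    change (T.mesh.cell K).avg (c • u K l) = c * (T.mesh.cell K).avg (u K l)
    rw [MvPolynomial.smul_eq_C_mul, PolygonalCell.avg_C_mul]

theorem cellAvg_sum {κ : Type*} (s : Finset κ) (u : κ → PW ι) (K : ι) :
    T.cellAvg (∑ i ∈ s, u i) K = ∑ i ∈ s, T.cellAvg (u i) K := by
  classical
  induction s using Finset.induction_on with
  | empty =>
    simp only [Finset.sum_empty]
    simpa using T.cellAvg_smul 0 0 K
  | insert i s hi ih => rw [Finset.sum_insert hi, Finset.sum_insert hi, cellAvg_add, ih]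

end Discretization

end

end RMHD

/-! ### Induction over time levels and stages -/

open RMHD
theorem mainTheorem3 (H : ℝ → ℝ → ℝ) (hH : IsCausalEOS H)
    {ι : Type*} [Fintype ι] (k : ℕ) (T : Discretization ι k)
    (bc : BoundaryRule T)
    (hbc : ∀ u ∈ T.strongSet H, ∀ K j q, T.mesh.neighbor K j = none → bc u K j q ∈ Adm H)
    (ε : PW ι → ℝ) (hε : T.IsThresholdRule H ε)
    (U₀ : Pt → State)
    (hU₀L2 : ∀ l, MemLp (fun x => U₀ x l) 2 (volume.restrict T.mesh.domain))
    (hU₀ : ∀ x ∈ T.mesh.domain, U₀ x ∈ Adm H)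
    (Nr : ℕ) (α β : ℕ → ℕ → ℝ) (hαβ : IsSSPCoeff Nr α β)
    (Nt : ℕ) (Δt : ℕ → ℝ) (hΔt : ∀ n < Nt, 0 < Δt n)
    (U : ℕ → ℕ → PW ι) (hU : T.IsRKDGSolution H bc ε U₀ Nr α β Nt Δt U)
    (hCFL : T.CFL H bc Nr β Nt Δt U) :
    ∀ n ≤ Nt, U n 0 ∈ T.strongSet H := by
  have hlim : ∀ u ∈ T.weakSet H, T.limiter (ε u) u ∈ T.strongSet H := fun u hu =>
    T.limiter_mem_strongSet hH hu (hε u hu).1 (hε u hu).2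
  intro n
  induction n with
  | zero =>
    intro _
    rw [hU.initial]
    exact hlim _ (T.cellAvg_Pw_mem hH hU₀L2 hU₀)
  | succ n ih =>
    intro hn
    have hn' : n < Nt := hn
    have h0 := ih hn'.le
    suffices h : ∀ i ≤ Nr, U n i ∈ T.strongSet H by
      rw [hU.next n hn']
      exact h Nr le_rfl
    intro i
    induction i using Nat.strong_induction_on with
    | _ i ihi =>
      intro hi
      rcases Nat.eq_zero_or_pos i with rfl | hi1
      · exact h0
      rw [hU.stage n hn' i hi1 hi]
      obtain ⟨hαβ0, hα1⟩ := hαβ i hi1 hi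
      refine hlim _ ⟨Submodule.sum_mem _ fun l hl => ?_, fun K => ?_⟩
      · have hl' := Finset.mem_range.1 hl
        exact Submodule.smul_mem _ _ (Submodule.add_mem _ (ihi l hl' (hl'.le.trans hi)).1.1
          (Submodule.smul_mem _ _
            (Classical.epsilon_spec (T.exists_isSpatialOperator H bc (U n l))).1))
      · rw [T.cellAvg_sum]
        simp only [T.cellAvg_smul, T.cellAvg_add]
        refine (convex_adm hH).sum_mem (fun l hl => (hαβ0 l (Finset.mem_range.1 hl)).1) hα1
          fun l hl => ?_
        have hl' := Finset.mem_range.1 hl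
        have hs := ihi l hl' (hl'.le.trans hi)
        -- For β = 0 the CFL condition is void and the term is an admissible average. Otherwise it
        -- is a forward Euler step of length `β i l * Δt n`.
        rcases (hαβ0 l hl').2.eq_or_lt with hβ | hβ
        · rw [← hβ, zero_mul, zero_smul, add_zero]
          exact hs.1.2 K
        · refine T.euler_mem_adm hH hs (hbc _ hs) (mul_pos hβ (hΔt n hn')) fun j q => ?_
          have h := hCFL n hn' i hi1 hi l hl' hβ.ne' K j q
          have hσ : 0 < Discretization.visc + T.sigma H bc (U n l) K j q :=
            add_pos_of_pos_of_nonneg one_pos (T.sigma_nonneg bc (U n l) K j q)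
          have hω := T.edgeRule.weight_pos q
          have hlen := (T.mesh.cell K).len_pos j
          rw [le_div_iff₀ (by positivity)] at h
          linarith
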